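/- **Conventions.** A Gray category $\mathcal G$ consists of objects, a strict 2-category $\mathcal G(\mathcal C,\mathcal D)$ for each pair of objects (its objects, 1- and 2-morphisms are the 1-, 2- and 3-morphisms of $\mathcal G$; $\circ$ is horizontal and $\cdot$ vertical composition), a strictly associative and unital product $\Box$ of a 1-morphism with 1-, 2- and 3-morphisms such that $G\Box-$ and $-\Box F$ are strict 2-functors, and invertible 3-morphisms (the tensorator) $$\sigma_{\mu,\nu}:(\mu\Box F_2)\circ(G_1\Box\nu)\Rrightarrow(G_2\Box\nu)\circ(\mu\Box F_1)\qquad(\nu:F_1\Rightarrow F_2,\ \mu:G_1\Rightarrow G_2)$$ that are natural in both arguments, trivial if $\mu$ or $\nu$ is an identity, compatible with $\circ$ in each argument (hexagon identities), and satisfy $\sigma_{\mu\Box F,\nu}=\sigma_{\mu,F\Box\nu}$, $\sigma_{F\Box\mu,\nu}=F\Box\sigma_{\mu,\nu}$, $\sigma_{\mu,\nu\Box F}=\sigma_{\mu,\nu}\Box F$. A Gray category with duals is a Gray category $\mathcal G$ with the following structure. 1. On each $\mathcal G(\mathcal C,\mathcal D)$ a planar structure: a strict 2-functor $*$ that is the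 identity on 1-morphisms of $\mathcal G$, reverses $\circ$ and $\cdot$, and satisfies $**=1$, together with 3-morphisms $\epsilon_\mu:1_G\Rrightarrow\mu\circ\mu^*$ for $\mu:F\Rightarrow G$ such that $(\alpha\circ1_{\mu^*})\cdot\epsilon_\mu=(1_\nu\circ\alpha^*)\cdot\epsilon_\nu$ for $\alpha:\mu\Rrightarrow\nu$, $(1_\mu\circ\epsilon_{\mu^*}^*)\cdot(\epsilon_\mu\circ1_\mu)=1_\mu$ and $(1_\mu\circ\epsilon_\rho\circ1_{\mu^*})\cdot\epsilon_\mu=\epsilon_{\mu\circ\rho}$; moreover $(K\Box\mu\Box H)^*=K\Box\mu^*\Box H$ and $K\Box\epsilon_\mu\Box H=\epsilon_{K\Box\mu\Box H}$. 2. For each 1-morphism $F:\mathcal C\to\mathcal D$ a dual $F^\#:\mathcal D\to\mathcal C$, a 2-morphism $\eta_F:1_{\mathcal D}\Rightarrow F\Box F^\#$ and an invertible 3-morphism $T_F:(\eta_F^*\Box F)\circ(F\Box\eta_{F^\#})\Rrightarrow1_F$ such that (a) $F^{\#\#}=F$; (b) $1_{\mathcal C}^\#=1_{\mathcal C}$,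 and $\eta_{1_{\mathcal C}}$, $T_{1_{\mathcal C}}$ are identities; (c) $(F\Box G)^\#=G^\#\Box F^\#$, $\eta_{F\Box G}=(F\Box\eta_G\Box F^\#)\circ\eta_F$ and $T_{F\Box G}=\big((T_F\Box G)\circ(F\Box T_G)\big)\cdot\big(1_{\eta_F^*\Box F\Box G}\circ\sigma_{F\Box\eta_G^*,\,\eta_{F^\#}\Box G}\circ1_{F\Box G\Box\eta_{G^\#}}\big)$; (d) $(1_{\eta_F^*}\circ(T_F\Box F^\#))\cdot(\sigma_{\eta_F^*,\eta_F^*}\circ1_{F\Box\eta_{F^\#}\Box F^\#})\cdot(1_{\eta_F^*}\circ(F\Box T_{F^\#}^*))=1_{\eta_F^*}$. For a 2-morphism $\nu:F\Rightarrow G$ and a 3-morphism $\Phi:\nu\Rrightarrow\nu'$ with $\nu':F\Rightarrow G$ put $$\#\nu=(F^\#\Box\eta_G^*)\circ(F^\#\Box\nu\Box G^\#)\circ(\eta_{F^\#}\Box G^\#):G^\#\Rightarrow F^\#,$$ $$\#\Phi=1_{F^\#\Box\eta_G^*}\circ(F^\#\Box\Phi\Box G^\#)\circ1_{\eta_{F^\#}\Box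 G^\#}:\#\nu\Rrightarrow\#\nu'.$$ Write $*\#*\nu=(\#(\nu^*))^*:G^\#\Rightarrow F^\#$. The natural isomorphism $\Delta:\#\to*\#*$ has as its component $\Delta_\nu:\#\nu\Rrightarrow*\#*\nu$ the composite (omitting $\Box$) $$\begin{aligned}\Delta_\nu=\;&\big(1_{*\#*\nu}\circ(T_{G^\#}^*)^{-1}\big)\cdot\big(1_{*\#*\nu}\circ1_{G^\#\eta_G^*}\circ G^\#\epsilon_\nu^*G^\#\circ1_{\eta_{G^\#}G^\#}\big)\\ &\cdot\big(1_{*\#*\nu}\circ1_{G^\#\eta_G^*\circ G^\#\nu G^\#}\circ G^\#T_FG^\#\circ1_{G^\#\nu^*G^\#\circ\eta_{G^\#}G^\#}\big)\\ &\cdot\big(1_{*\#*\nu}\circ\sigma_{G^\#\eta_F^*,\;\eta_G^*\circ\nu G^\#}\circ1_{G^\#F\eta_{F^\#}G^\#\circ G^\#\nu^*G^\#\circ\eta_{G^\#}G^\#}\big)\\ &\cdot\big(1_{*\#*\nu}\circ1_{G^\#\eta_F^*}\circ\sigma_{G^\#\nu^*\circ\eta_{G^\#},\;\#\nu}\big)\cdot\big(\epsilon_{*\#*\nu}\circ1_{\#\nu}\big).\end{aligned}$$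 $\mathcal G$ is called *spatial* if the natural isomorphisms $\Delta$ and $*\Delta*$ from $\#$ to $*\#*$ are equal, that is, $\Delta_\nu=(\Delta_{\nu^*})^*$ for all 2-morphisms $\nu$. The left and right trace of a 3-morphism $\Psi:\mu\Rrightarrow\mu$ with $\mu:F\Rightarrow G$ are $$\mathrm{tr}_L(\Psi)=\epsilon_\mu^*\cdot(\Psi\circ1_{\mu^*})\cdot\epsilon_\mu:1_G\Rrightarrow1_G,\qquad\mathrm{tr}_R(\Psi)=\epsilon_{\mu^*}^*\cdot(1_{\mu^*}\circ\Psi)\cdot\epsilon_{\mu^*}:1_F\Rrightarrow1_F.$$ **Lemma.** Every spatial Gray category with duals is spherical: for all 2-morphisms $\mu:F\Rightarrow G$ and all 3-morphisms $\Psi:\mu\Rrightarrow\mu$, $$1_{\eta_G^*}\circ(\mathrm{tr}_L(\Psi)\Box G^\#)=1_{\eta_G^*}\circ(G\Box\mathrm{tr}_R(\#\Psi)),$$ $$1_{\eta_F^*}\circ(\mathrm{tr}_R(\Psi)\Box F^\#)=1_{\eta_F^*}\circ(F\Box\mathrm{tr}_L(\#\Psi)).$$ -/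

import Mathlib

universe u₀ u₁ u₂ u₃

/-!
Strict higher categories in globular form: there is one type of cells in each dimension, with source
and target maps, so that strict associativity and unitality are plain equations between cells.
Each composition is a binary operation whose values matter on composable pairs only; every law about
a composition is required for composable cells, and nothing is assumed about other pairs.
-/

/-- A (strict) 2-category, with objects `Cell₀`, 1-morphisms `Cell₁` and 2-morphisms `Cell₂`.
`hcomp₁ g f` is `g ∘ f` (for `src g = tgt f`), `hcomp₂ β α` is the horizontal composite `β ∘ α` of
2-morphisms (for `src (dom β) = tgt (dom α)`), and `vcomp β α` is the vertical composite `β · α`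
(for `dom β = cod α`). -/
structure TwoCategory where
  Cell₀ : Type u₀
  Cell₁ : Type u₁
  Cell₂ : Type u₂
  src : Cell₁ → Cell₀
  tgt : Cell₁ → Cell₀
  dom : Cell₂ → Cell₁
  cod : Cell₂ → Cell₁
  src_cod : ∀ α, src (cod α) = src (dom α)
  tgt_cod : ∀ α, tgt (cod α) = tgt (dom α)
  id₁ : Cell₀ → Cell₁
  id₂ : Cell₁ → Cell₂
  hcomp₁ : Cell₁ → Cell₁ → Cell₁
  hcomp₂ : Cell₂ → Cell₂ → Cell₂
  vcomp : Cell₂ → Cell₂ → Cell₂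
  -- sources and targets
  src_id₁ : ∀ A, src (id₁ A) = A
  tgt_id₁ : ∀ A, tgt (id₁ A) = A
  dom_id₂ : ∀ a, dom (id₂ a) = a
  cod_id₂ : ∀ a, cod (id₂ a) = a
  src_hcomp₁ : ∀ g f, src g = tgt f → src (hcomp₁ g f) = src f
  tgt_hcomp₁ : ∀ g f, src g = tgt f → tgt (hcomp₁ g f) = tgt g
  dom_hcomp₂ : ∀ β α, src (dom β) = tgt (dom α) → dom (hcomp₂ β α) = hcomp₁ (dom β) (dom α)
  cod_hcomp₂ : ∀ β α, src (dom β) = tgt (dom α) → cod (hcomp₂ β α) = hcomp₁ (cod β) (cod α)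
  dom_vcomp : ∀ β α, dom β = cod α → dom (vcomp β α) = dom α
  cod_vcomp : ∀ β α, dom β = cod α → cod (vcomp β α) = cod β
  -- the 1-morphisms and 2-morphisms between two given objects form a category
  id_vcomp : ∀ α, vcomp (id₂ (cod α)) α = α
  vcomp_id : ∀ α, vcomp α (id₂ (dom α)) = α
  vcomp_assoc : ∀ γ β α, dom γ = cod β → dom β = cod α →
    vcomp (vcomp γ β) α = vcomp γ (vcomp β α)
  -- horizontal composition is strictly unital and associative
  id_hcomp₁ : ∀ f, hcomp₁ (id₁ (tgt f)) f = f
  hcomp₁_id : ∀ f, hcomp₁ f (id₁ (src f)) = f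
  hcomp₁_assoc : ∀ h g f, src h = tgt g → src g = tgt f →
    hcomp₁ (hcomp₁ h g) f = hcomp₁ h (hcomp₁ g f)
  id_hcomp₂ : ∀ α, hcomp₂ (id₂ (id₁ (tgt (dom α)))) α = α
  hcomp₂_id : ∀ α, hcomp₂ α (id₂ (id₁ (src (dom α)))) = α
  hcomp₂_assoc : ∀ γ β α, src (dom γ) = tgt (dom β) → src (dom β) = tgt (dom α) →
    hcomp₂ (hcomp₂ γ β) α = hcomp₂ γ (hcomp₂ β α)
  -- horizontal composition is functorial
  id₂_hcomp₁ : ∀ g f, src g = tgt f → id₂ (hcomp₁ g f) = hcomp₂ (id₂ g) (id₂ f)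
  interchange : ∀ β' β α' α, dom β' = cod β → dom α' = cod α → src (dom β) = tgt (dom α) →
    hcomp₂ (vcomp β' β) (vcomp α' α) = vcomp (hcomp₂ β' α') (hcomp₂ β α)

/-- Horizontal composition of 1-morphisms. -/
infixr:80 " ∘₁ " => TwoCategory.hcomp₁ _

/-- Horizontal composition of 2-morphisms. -/
infixr:80 " ∘₂ " => TwoCategory.hcomp₂ _

/-- Vertical composition of 2-morphisms. -/
infixr:70 " ⊙ " => TwoCategory.vcomp _

namespace TwoCategory

/-- `β` is a (two-sided, vertical) inverse of the 2-morphism `α`. -/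
def IsInverse (K : TwoCategory.{u₀, u₁, u₂}) (β α : K.Cell₂) : Prop :=
  K.dom β = K.cod α ∧ K.cod β = K.dom α ∧
    β ⊙ α = K.id₂ (K.dom α) ∧ α ⊙ β = K.id₂ (K.cod α)

/-- The 2-morphism `α` is invertible. -/
def IsInvertible (K : TwoCategory.{u₀, u₁, u₂}) (α : K.Cell₂) : Prop :=
  ∃ β, K.IsInverse β α

open Classical in
/-- The inverse of an invertible 2-morphism (a junk value if `α` is not invertible). -/
noncomputable def inv (K : TwoCategory.{u₀, u₁, u₂}) (α : K.Cell₂) : K.Cell₂ :=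
  if h : K.IsInvertible α then h.choose else α

theorem inv_isInverse (K : TwoCategory.{u₀, u₁, u₂}) {α : K.Cell₂} (h : K.IsInvertible α) :
    K.IsInverse (K.inv α) α := by
  unfold inv
  rw [dif_pos h]
  exact h.choose_spec

end TwoCategory

/-- The structure of a planar 2-category on a 2-category `K`: a strict contravariant functor `*`
that is the identity on objects and reverses both compositions, with `** = 1`, and 2-morphisms
`ε a : 1 → a ∘ a*`. -/
structure PlanarStructure (K : TwoCategory.{u₀, u₁, u₂}) where
  star₁ : K.Cell₁ → K.Cell₁
  star₂ : K.Cell₂ → K.Cell₂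
  ε : K.Cell₁ → K.Cell₂
  src_star₁ : ∀ a, K.src (star₁ a) = K.tgt a
  tgt_star₁ : ∀ a, K.tgt (star₁ a) = K.src a
  dom_star₂ : ∀ α, K.dom (star₂ α) = star₁ (K.cod α)
  cod_star₂ : ∀ α, K.cod (star₂ α) = star₁ (K.dom α)
  star₁_id₁ : ∀ A, star₁ (K.id₁ A) = K.id₁ A
  star₂_id₂ : ∀ a, star₂ (K.id₂ a) = K.id₂ (star₁ a)
  star₁_hcomp₁ : ∀ b a, K.src b = K.tgt a → star₁ (b ∘₁ a) = star₁ a ∘₁ star₁ b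
  star₂_hcomp₂ : ∀ β α, K.src (K.dom β) = K.tgt (K.dom α) →
    star₂ (β ∘₂ α) = star₂ α ∘₂ star₂ β
  star₂_vcomp : ∀ β α, K.dom β = K.cod α → star₂ (β ⊙ α) = star₂ α ⊙ star₂ β
  star₁_star₁ : ∀ a, star₁ (star₁ a) = a
  star₂_star₂ : ∀ α, star₂ (star₂ α) = α
  dom_ε : ∀ a, K.dom (ε a) = K.id₁ (K.tgt a)
  cod_ε : ∀ a, K.cod (ε a) = a ∘₁ star₁ a
  ε_natural : ∀ α, (α ∘₂ K.id₂ (star₁ (K.dom α))) ⊙ ε (K.dom α) =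
    (K.id₂ (K.cod α) ∘₂ star₂ α) ⊙ ε (K.cod α)
  ε_snake : ∀ a, (K.id₂ a ∘₂ star₂ (ε (star₁ a))) ⊙ (ε a ∘₂ K.id₂ a) = K.id₂ a
  ε_hcomp₁ : ∀ a c, K.src a = K.tgt c →
    (K.id₂ a ∘₂ ε c ∘₂ K.id₂ (star₁ a)) ⊙ ε a = ε (a ∘₁ c)

/-- A Gray category. The 2-categories `𝒢(C, D)` for all pairs of objects are collected in one
2-category (their disjoint union), whose objects, 1-morphisms and 2-morphisms are the 1-, 2- and
3-morphisms of the Gray category; `source` and `target` give the objects `C` and `D`.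

The Gray product `□` is given by `box G F = G □ F` for 1-morphisms, by `lbox₁ G μ = G □ μ` and
`rbox₁ μ F = μ □ F` for a 1-morphism and a 2-morphism, and by `lbox₂ G Φ = G □ Φ` and
`rbox₂ Φ F = Φ □ F` for a 1-morphism and a 3-morphism. The tensorator is `σ`. -/
structure GrayCategory extends TwoCategory.{u₁, u₂, u₃} where
  Obj : Type u₀
  source : Cell₀ → Obj
  target : Cell₀ → Obj
  source_tgt : ∀ μ, source (tgt μ) = source (src μ)
  target_tgt : ∀ μ, target (tgt μ) = target (src μ)
  unit : Obj → Cell₀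
  box : Cell₀ → Cell₀ → Cell₀
  lbox₁ : Cell₀ → Cell₁ → Cell₁
  rbox₁ : Cell₁ → Cell₀ → Cell₁
  lbox₂ : Cell₀ → Cell₂ → Cell₂
  rbox₂ : Cell₂ → Cell₀ → Cell₂
  source_unit : ∀ C, source (unit C) = C
  target_unit : ∀ C, target (unit C) = C
  source_box : ∀ G F, source G = target F → source (box G F) = source F
  target_box : ∀ G F, source G = target F → target (box G F) = target G
  -- `G □ -` is a strict 2-functor
  src_lbox₁ : ∀ G μ, source G = target (src μ) → src (lbox₁ G μ) = box G (src μ)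
  tgt_lbox₁ : ∀ G μ, source G = target (src μ) → tgt (lbox₁ G μ) = box G (tgt μ)
  dom_lbox₂ : ∀ G Φ, source G = target (src (dom Φ)) → dom (lbox₂ G Φ) = lbox₁ G (dom Φ)
  cod_lbox₂ : ∀ G Φ, source G = target (src (dom Φ)) → cod (lbox₂ G Φ) = lbox₁ G (cod Φ)
  lbox₁_id₁ : ∀ G F, source G = target F → lbox₁ G (id₁ F) = id₁ (box G F)
  lbox₂_id₂ : ∀ G μ, source G = target (src μ) → lbox₂ G (id₂ μ) = id₂ (lbox₁ G μ)
  lbox₁_hcomp₁ : ∀ G ν μ, source G = target (src μ) → src ν = tgt μ →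
    lbox₁ G (hcomp₁ ν μ) = hcomp₁ (lbox₁ G ν) (lbox₁ G μ)
  lbox₂_hcomp₂ : ∀ G Ψ Φ, source G = target (src (dom Φ)) → src (dom Ψ) = tgt (dom Φ) →
    lbox₂ G (hcomp₂ Ψ Φ) = hcomp₂ (lbox₂ G Ψ) (lbox₂ G Φ)
  lbox₂_vcomp : ∀ G Ψ Φ, source G = target (src (dom Φ)) → dom Ψ = cod Φ →
    lbox₂ G (vcomp Ψ Φ) = vcomp (lbox₂ G Ψ) (lbox₂ G Φ)
  -- `- □ F` is a strict 2-functor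
  src_rbox₁ : ∀ μ F, source (src μ) = target F → src (rbox₁ μ F) = box (src μ) F
  tgt_rbox₁ : ∀ μ F, source (src μ) = target F → tgt (rbox₁ μ F) = box (tgt μ) F
  dom_rbox₂ : ∀ Φ F, source (src (dom Φ)) = target F → dom (rbox₂ Φ F) = rbox₁ (dom Φ) F
  cod_rbox₂ : ∀ Φ F, source (src (dom Φ)) = target F → cod (rbox₂ Φ F) = rbox₁ (cod Φ) F
  rbox₁_id₁ : ∀ G F, source G = target F → rbox₁ (id₁ G) F = id₁ (box G F)
  rbox₂_id₂ : ∀ μ F, source (src μ) = target F → rbox₂ (id₂ μ) F = id₂ (rbox₁ μ F)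
  rbox₁_hcomp₁ : ∀ ν μ F, source (src μ) = target F → src ν = tgt μ →
    rbox₁ (hcomp₁ ν μ) F = hcomp₁ (rbox₁ ν F) (rbox₁ μ F)
  rbox₂_hcomp₂ : ∀ Ψ Φ F, source (src (dom Φ)) = target F → src (dom Ψ) = tgt (dom Φ) →
    rbox₂ (hcomp₂ Ψ Φ) F = hcomp₂ (rbox₂ Ψ F) (rbox₂ Φ F)
  rbox₂_vcomp : ∀ Ψ Φ F, source (src (dom Φ)) = target F → dom Ψ = cod Φ →
    rbox₂ (vcomp Ψ Φ) F = vcomp (rbox₂ Ψ F) (rbox₂ Φ F)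
  -- `□` is strictly unital
  unit_box : ∀ F, box (unit (target F)) F = F
  box_unit : ∀ F, box F (unit (source F)) = F
  unit_lbox₁ : ∀ μ, lbox₁ (unit (target (src μ))) μ = μ
  rbox₁_unit : ∀ μ, rbox₁ μ (unit (source (src μ))) = μ
  unit_lbox₂ : ∀ Φ, lbox₂ (unit (target (src (dom Φ)))) Φ = Φ
  rbox₂_unit : ∀ Φ, rbox₂ Φ (unit (source (src (dom Φ)))) = Φ
  -- `□` is strictly associative on triples of which at least two are 1-morphisms
  box_assoc : ∀ P Q R, source P = target Q → source Q = target R →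
    box (box P Q) R = box P (box Q R)
  lbox₁_lbox₁ : ∀ P Q μ, source P = target Q → source Q = target (src μ) →
    lbox₁ (box P Q) μ = lbox₁ P (lbox₁ Q μ)
  lbox₁_rbox₁ : ∀ P μ R, source P = target (src μ) → source (src μ) = target R →
    rbox₁ (lbox₁ P μ) R = lbox₁ P (rbox₁ μ R)
  rbox₁_rbox₁ : ∀ μ Q R, source (src μ) = target Q → source Q = target R →
    rbox₁ (rbox₁ μ Q) R = rbox₁ μ (box Q R)
  lbox₂_lbox₂ : ∀ P Q Φ, source P = target Q → source Q = target (src (dom Φ)) →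
    lbox₂ (box P Q) Φ = lbox₂ P (lbox₂ Q Φ)
  lbox₂_rbox₂ : ∀ P Φ R, source P = target (src (dom Φ)) → source (src (dom Φ)) = target R →
    rbox₂ (lbox₂ P Φ) R = lbox₂ P (rbox₂ Φ R)
  rbox₂_rbox₂ : ∀ Φ Q R, source (src (dom Φ)) = target Q → source Q = target R →
    rbox₂ (rbox₂ Φ Q) R = rbox₂ Φ (box Q R)
  -- the tensorator `σ μ ν : (μ □ F₂) ∘ (G₁ □ ν) ⇛ (G₂ □ ν) ∘ (μ □ F₁)`
  -- for `ν : F₁ ⇒ F₂` and `μ : G₁ ⇒ G₂`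
  σ : Cell₁ → Cell₁ → Cell₂
  dom_σ : ∀ μ ν, source (src μ) = target (src ν) →
    dom (σ μ ν) = hcomp₁ (rbox₁ μ (tgt ν)) (lbox₁ (src μ) ν)
  cod_σ : ∀ μ ν, source (src μ) = target (src ν) →
    cod (σ μ ν) = hcomp₁ (lbox₁ (tgt μ) ν) (rbox₁ μ (src ν))
  σ_invertible : ∀ μ ν, source (src μ) = target (src ν) →
    toTwoCategory.IsInvertible (σ μ ν)
  σ_id_right : ∀ μ F, source (src μ) = target F → σ μ (id₁ F) = id₂ (rbox₁ μ F)
  σ_id_left : ∀ G ν, source G = target (src ν) → σ (id₁ G) ν = id₂ (lbox₁ G ν)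
  σ_natural_right : ∀ μ Φ, source (src μ) = target (src (dom Φ)) →
    vcomp (σ μ (cod Φ)) (hcomp₂ (id₂ (rbox₁ μ (tgt (dom Φ)))) (lbox₂ (src μ) Φ)) =
      vcomp (hcomp₂ (lbox₂ (tgt μ) Φ) (id₂ (rbox₁ μ (src (dom Φ))))) (σ μ (dom Φ))
  σ_natural_left : ∀ Ψ ν, source (src (dom Ψ)) = target (src ν) →
    vcomp (σ (cod Ψ) ν) (hcomp₂ (rbox₂ Ψ (tgt ν)) (id₂ (lbox₁ (src (dom Ψ)) ν))) =
      vcomp (hcomp₂ (id₂ (lbox₁ (tgt (dom Ψ)) ν)) (rbox₂ Ψ (src ν))) (σ (dom Ψ) ν)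
  σ_hcomp_right : ∀ μ ν' ν, source (src μ) = target (src ν) → src ν' = tgt ν →
    σ μ (hcomp₁ ν' ν) =
      vcomp (hcomp₂ (id₂ (lbox₁ (tgt μ) ν')) (σ μ ν)) (hcomp₂ (σ μ ν') (id₂ (lbox₁ (src μ) ν)))
  σ_hcomp_left : ∀ μ' μ ν, source (src μ) = target (src ν) → src μ' = tgt μ →
    σ (hcomp₁ μ' μ) ν =
      vcomp (hcomp₂ (σ μ' ν) (id₂ (rbox₁ μ (src ν)))) (hcomp₂ (id₂ (rbox₁ μ' (tgt ν))) (σ μ ν))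
  σ_rbox_left : ∀ μ F ν, source (src μ) = target F → source F = target (src ν) →
    σ (rbox₁ μ F) ν = σ μ (lbox₁ F ν)
  σ_lbox_left : ∀ F μ ν, source F = target (src μ) → source (src μ) = target (src ν) →
    σ (lbox₁ F μ) ν = lbox₂ F (σ μ ν)
  σ_rbox_right : ∀ μ ν F, source (src μ) = target (src ν) → source (src ν) = target F →
    σ μ (rbox₁ ν F) = rbox₂ (σ μ ν) F

/-- Gray product of two 1-morphisms. -/
infixr:90 " □₀ " => GrayCategory.box _

/-- Gray product `G □ μ` of a 1-morphism and a 2-morphism. -/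
infixr:90 " ◁₁ " => GrayCategory.lbox₁ _

/-- Gray product `μ □ F` of a 2-morphism and a 1-morphism. -/
infixr:90 " ▷₁ " => GrayCategory.rbox₁ _

/-- Gray product `G □ Φ` of a 1-morphism and a 3-morphism. -/
infixr:90 " ◁₂ " => GrayCategory.lbox₂ _

/-- Gray product `Φ □ F` of a 3-morphism and a 1-morphism. -/
infixr:90 " ▷₂ " => GrayCategory.rbox₂ _

namespace GrayCategory

/-- The 1-morphisms of a Gray category. -/
abbrev Hom₁ (𝒢 : GrayCategory.{u₀, u₁, u₂, u₃}) : Type u₁ := 𝒢.Cell₀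

/-- The 2-morphisms of a Gray category. -/
abbrev Hom₂ (𝒢 : GrayCategory.{u₀, u₁, u₂, u₃}) : Type u₂ := 𝒢.Cell₁

/-- The 3-morphisms of a Gray category. -/
abbrev Hom₃ (𝒢 : GrayCategory.{u₀, u₁, u₂, u₃}) : Type u₃ := 𝒢.Cell₂

/-- The structure of a Gray category with duals on a Gray category `𝒢`: a planar structure on all
2-categories `𝒢(C, D)` that is compatible with the Gray product, and for each 1-morphism `F` a dual
`sharp F = F^#`, a fold `η F : 1 ⇒ F □ F^#` and an invertible triangulator
`T F : (η_F^* □ F) ∘ (F □ η_{F^#}) ⇛ 1_F`. -/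
structure Duals (𝒢 : GrayCategory.{u₀, u₁, u₂, u₃})
    extends PlanarStructure 𝒢.toTwoCategory where
  star₁_box : ∀ (K : 𝒢.Hom₁) (μ : 𝒢.Hom₂) (H : 𝒢.Hom₁),
    𝒢.source K = 𝒢.target (𝒢.src μ) → 𝒢.source (𝒢.src μ) = 𝒢.target H →
    star₁ (K ◁₁ (μ ▷₁ H)) = K ◁₁ (star₁ μ ▷₁ H)
  ε_box : ∀ (K : 𝒢.Hom₁) (μ : 𝒢.Hom₂) (H : 𝒢.Hom₁),
    𝒢.source K = 𝒢.target (𝒢.src μ) → 𝒢.source (𝒢.src μ) = 𝒢.target H →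
    K ◁₂ (ε μ ▷₂ H) = ε (K ◁₁ (μ ▷₁ H))
  sharp : 𝒢.Hom₁ → 𝒢.Hom₁
  source_sharp : ∀ F, 𝒢.source (sharp F) = 𝒢.target F
  target_sharp : ∀ F, 𝒢.target (sharp F) = 𝒢.source F
  η : 𝒢.Hom₁ → 𝒢.Hom₂
  src_η : ∀ F, 𝒢.src (η F) = 𝒢.unit (𝒢.target F)
  tgt_η : ∀ F, 𝒢.tgt (η F) = F □₀ sharp F
  T : 𝒢.Hom₁ → 𝒢.Hom₃
  dom_T : ∀ F, 𝒢.dom (T F) = (star₁ (η F) ▷₁ F) ∘₁ (F ◁₁ η (sharp F))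
  cod_T : ∀ F, 𝒢.cod (T F) = 𝒢.id₁ F
  T_invertible : ∀ F, 𝒢.IsInvertible (T F)
  sharp_sharp : ∀ F, sharp (sharp F) = F
  sharp_unit : ∀ C, sharp (𝒢.unit C) = 𝒢.unit C
  η_unit : ∀ C, η (𝒢.unit C) = 𝒢.id₁ (𝒢.unit C)
  T_unit : ∀ C, T (𝒢.unit C) = 𝒢.id₂ (𝒢.id₁ (𝒢.unit C))
  sharp_box : ∀ F G : 𝒢.Hom₁, 𝒢.source F = 𝒢.target G →
    sharp (F □₀ G) = sharp G □₀ sharp F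
  η_box : ∀ F G : 𝒢.Hom₁, 𝒢.source F = 𝒢.target G →
    η (F □₀ G) = (F ◁₁ (η G ▷₁ sharp F)) ∘₁ η F
  T_box : ∀ F G : 𝒢.Hom₁, 𝒢.source F = 𝒢.target G →
    T (F □₀ G) =
      ((T F ▷₂ G) ∘₂ (F ◁₂ T G)) ⊙
      (𝒢.id₂ (star₁ (η F) ▷₁ (F □₀ G)) ∘₂
        𝒢.σ (F ◁₁ star₁ (η G)) (η (sharp F) ▷₁ G) ∘₂
        𝒢.id₂ ((F □₀ G) ◁₁ η (sharp G)))
  T_swallowtail : ∀ F : 𝒢.Hom₁,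
    (𝒢.id₂ (star₁ (η F)) ∘₂ (T F ▷₂ sharp F)) ⊙
      (𝒢.σ (star₁ (η F)) (star₁ (η F)) ∘₂ 𝒢.id₂ (F ◁₁ (η (sharp F) ▷₁ sharp F))) ⊙
      (𝒢.id₂ (star₁ (η F)) ∘₂ (F ◁₂ star₂ (T (sharp F)))) =
    𝒢.id₂ (star₁ (η F))

namespace Duals

variable {𝒢 : GrayCategory.{u₀, u₁, u₂, u₃}}

/-- The dual `#ν : G^# ⇒ F^#` of a 2-morphism `ν : F ⇒ G`,
`#ν = (F^# □ η_G^*) ∘ (F^# □ ν □ G^#) ∘ (η_{F^#} □ G^#)`. -/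
def sharp₁ (D : 𝒢.Duals) (ν : 𝒢.Hom₂) : 𝒢.Hom₂ :=
  (D.sharp (𝒢.src ν) ◁₁ D.star₁ (D.η (𝒢.tgt ν))) ∘₁
    (D.sharp (𝒢.src ν) ◁₁ (ν ▷₁ D.sharp (𝒢.tgt ν))) ∘₁
    (D.η (D.sharp (𝒢.src ν)) ▷₁ D.sharp (𝒢.tgt ν))

/-- The dual `#Φ : #μ ⇛ #ν` of a 3-morphism `Φ : μ ⇛ ν` between 2-morphisms `μ, ν : F ⇒ G`,
`#Φ = 1_{F^# □ η_G^*} ∘ (F^# □ Φ □ G^#) ∘ 1_{η_{F^#} □ G^#}`. -/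
def sharp₂ (D : 𝒢.Duals) (Φ : 𝒢.Hom₃) : 𝒢.Hom₃ :=
  𝒢.id₂ (D.sharp (𝒢.src (𝒢.dom Φ)) ◁₁ D.star₁ (D.η (𝒢.tgt (𝒢.dom Φ)))) ∘₂
    (D.sharp (𝒢.src (𝒢.dom Φ)) ◁₂ (Φ ▷₂ D.sharp (𝒢.tgt (𝒢.dom Φ)))) ∘₂
    𝒢.id₂ (D.η (D.sharp (𝒢.src (𝒢.dom Φ))) ▷₁ D.sharp (𝒢.tgt (𝒢.dom Φ)))

/-- The 2-morphism `*#*ν : G^# ⇒ F^#`. -/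
def starSharpStar₁ (D : 𝒢.Duals) (ν : 𝒢.Hom₂) : 𝒢.Hom₂ :=
  D.star₁ (D.sharp₁ (D.star₁ ν))

/-- The component `Δ_ν : #ν ⇛ *#*ν` of the natural isomorphism `Δ : # → *#*` at a 2-morphism
`ν : F ⇒ G`. It is the composite `#ν ⇛ *#*ν ∘ #*ν ∘ #ν ⇛ *#*ν`, where the first 3-morphism is
`ε_{*#*ν} ∘ 1_{#ν}`, and the second one contracts `#*ν ∘ #ν` to `#(ν ∘ ν*)` by the tensorators and
the triangulator of `F`, then to `#1_G` by `ε_ν^*`, and then to the identity by the triangulator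
of `G^#`. -/
noncomputable def Delta (D : 𝒢.Duals) (ν : 𝒢.Hom₂) : 𝒢.Hom₃ :=
  let F := 𝒢.src ν
  let G := 𝒢.tgt ν
  let F' := D.sharp F
  let G' := D.sharp G
  let s := 𝒢.id₂ (D.starSharpStar₁ ν)
  (s ∘₂ 𝒢.inv (D.star₂ (D.T G'))) ⊙
  (s ∘₂ 𝒢.id₂ (G' ◁₁ D.star₁ (D.η G)) ∘₂ (G' ◁₂ (D.star₂ (D.ε ν) ▷₂ G')) ∘₂
    𝒢.id₂ (D.η G' ▷₁ G')) ⊙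
  (s ∘₂ 𝒢.id₂ ((G' ◁₁ D.star₁ (D.η G)) ∘₁ (G' ◁₁ (ν ▷₁ G'))) ∘₂ (G' ◁₂ (D.T F ▷₂ G')) ∘₂
    𝒢.id₂ ((G' ◁₁ (D.star₁ ν ▷₁ G')) ∘₁ (D.η G' ▷₁ G'))) ⊙
  (s ∘₂ 𝒢.σ (G' ◁₁ D.star₁ (D.η F)) (D.star₁ (D.η G) ∘₁ (ν ▷₁ G')) ∘₂
    𝒢.id₂ ((G' ◁₁ (F ◁₁ (D.η F' ▷₁ G'))) ∘₁ (G' ◁₁ (D.star₁ ν ▷₁ G')) ∘₁ (D.η G' ▷₁ G'))) ⊙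
  (s ∘₂ 𝒢.id₂ (G' ◁₁ D.star₁ (D.η F)) ∘₂
    𝒢.σ ((G' ◁₁ D.star₁ ν) ∘₁ D.η G') (D.sharp₁ ν)) ⊙
  (D.ε (D.starSharpStar₁ ν) ∘₂ 𝒢.id₂ (D.sharp₁ ν))

/-- The component `(Δ_{ν*})^* : #ν ⇛ *#*ν` of the natural isomorphism `*Δ* : # → *#*` at a
2-morphism `ν`. -/
noncomputable def starDeltaStar (D : 𝒢.Duals) (ν : 𝒢.Hom₂) : 𝒢.Hom₃ :=
  D.star₂ (D.Delta (D.star₁ ν))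

/-- A Gray category with duals is spatial if the natural isomorphisms `Δ` and `*Δ*` from `#` to
`*#*` are equal, i.e. have the same components. -/
def IsSpatial (D : 𝒢.Duals) : Prop :=
  ∀ ν : 𝒢.Hom₂, D.Delta ν = D.starDeltaStar ν

/-- The left trace `tr_L(Ψ) = ε_μ^* · (Ψ ∘ 1_{μ*}) · ε_μ : 1_G ⇛ 1_G` of a 3-morphism `Ψ : μ ⇛ μ`
with `μ : F ⇒ G`. -/
def trL (D : 𝒢.Duals) (Ψ : 𝒢.Hom₃) : 𝒢.Hom₃ :=
  D.star₂ (D.ε (𝒢.dom Ψ)) ⊙ (Ψ ∘₂ 𝒢.id₂ (D.star₁ (𝒢.dom Ψ))) ⊙ D.ε (𝒢.dom Ψ)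

/-- The right trace `tr_R(Ψ) = ε_{μ*}^* · (1_{μ*} ∘ Ψ) · ε_{μ*} : 1_F ⇛ 1_F` of a 3-morphism
`Ψ : μ ⇛ μ` with `μ : F ⇒ G`. -/
def trR (D : 𝒢.Duals) (Ψ : 𝒢.Hom₃) : 𝒢.Hom₃ :=
  D.star₂ (D.ε (D.star₁ (𝒢.dom Ψ))) ⊙ (𝒢.id₂ (D.star₁ (𝒢.dom Ψ)) ∘₂ Ψ) ⊙
    D.ε (D.star₁ (𝒢.dom Ψ))

/-- A Gray category with duals is spherical if for all 2-morphisms `μ : F ⇒ G` and 3-morphisms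
`Ψ : μ ⇛ μ` one has `1_{η_G^*} ∘ (tr_L(Ψ) □ G^#) = 1_{η_G^*} ∘ (G □ tr_R(#Ψ))` and
`1_{η_F^*} ∘ (tr_R(Ψ) □ F^#) = 1_{η_F^*} ∘ (F □ tr_L(#Ψ))`. -/
def IsSpherical (D : 𝒢.Duals) : Prop :=
  ∀ (F G : 𝒢.Hom₁) (μ : 𝒢.Hom₂) (Ψ : 𝒢.Hom₃),
    𝒢.src μ = F → 𝒢.tgt μ = G → 𝒢.dom Ψ = μ → 𝒢.cod Ψ = μ →
    𝒢.id₂ (D.star₁ (D.η G)) ∘₂ (D.trL Ψ ▷₂ D.sharp G) =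
        𝒢.id₂ (D.star₁ (D.η G)) ∘₂ (G ◁₂ D.trR (D.sharp₂ Ψ)) ∧
      𝒢.id₂ (D.star₁ (D.η F)) ∘₂ (D.trR Ψ ▷₂ D.sharp F) =
        𝒢.id₂ (D.star₁ (D.η F)) ∘₂ (F ◁₂ D.trL (D.sharp₂ Ψ))

end Duals

end GrayCategory

/-! The dual # transports the duality between μ and μ* to one between #μ and #μ*. It reverses ∘ up
to the invertible 3-morphisms `sharpComp`, and a triangulator identifies #1 with 1, so ε_ν and ε_ν^*
induce `copairing ν` and `pairing ν` relating 1 and #ν* ∘ #ν. These satisfy both snake identities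
(`pairing_copairing`, `copairing_pairing`), and closing up #Ψ with them gives the trace of Ψ, up to
whiskering with a fold.

The planar traces of #Ψ, however, are formed with ε_{#μ} and (#μ)*, not with #μ*. The comparison
between the two is Δ: by `Delta_eq_mate`, Δ_ν is the mate #ν ⇛ (#ν*)^* of `pairing ν`. Spatiality
therefore says that the mate of `pairing μ` is the star of the mate of `pairing μ*`. This is
precisely what allows the mate to be pulled out of the pairing, slid past #Ψ and absorbed by the
copairing, which leaves the planar trace (`traceR_eq`, `traceL_eq`). This last argument takes place
in an arbitrary planar 2-category.

Computations with # become manageable after capping, that is, after applying η_F^* ∘ (F □ -). No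
information is lost (`cap_injective`), and the invertible `unsharp ν` replaces a capped #ν by ν
itself. In this form pairing and copairing become ε_ν^* and ε_ν (`cap_pairing`,
`unsharpComp_vcomp_cap_copairing`), the snake identities for #μ become those for μ, and the capped
trace of #Ψ becomes the whiskered trace of Ψ. The only properties of the triangulators that enter
are invertibility and the swallowtail identity. -/

set_option linter.unusedSimpArgs false

/-! ### Calculus in strict 2-categories: interchange and invertible 2-morphisms. -/

namespace TwoCategory

variable (K : TwoCategory.{u₀, u₁, u₂})

attribute [simp] src_cod tgt_cod src_id₁ tgt_id₁ dom_id₂ cod_id₂ src_hcomp₁ tgt_hcomp₁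
  dom_hcomp₂ cod_hcomp₂ dom_vcomp cod_vcomp vcomp_assoc hcomp₁_assoc hcomp₂_assoc

@[simp] theorem id_vcomp_of_eq {a α} (h : K.cod α = a) : K.id₂ a ⊙ α = α := by
  subst h; exact K.id_vcomp α

@[simp] theorem vcomp_id_of_eq {a α} (h : K.dom α = a) : α ⊙ K.id₂ a = α := by
  subst h; exact K.vcomp_id α

@[simp] theorem id_hcomp₁_of_eq {A f} (h : K.tgt f = A) : K.id₁ A ∘₁ f = f := by
  subst h; exact K.id_hcomp₁ f

@[simp] theorem hcomp₁_id_of_eq {A f} (h : K.src f = A) : f ∘₁ K.id₁ A = f := by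
  subst h; exact K.hcomp₁_id f

@[simp] theorem id_hcomp₂_of_eq {A α} (h : K.tgt (K.dom α) = A) :
    K.id₂ (K.id₁ A) ∘₂ α = α := by
  subst h; exact K.id_hcomp₂ α

@[simp] theorem hcomp₂_id_of_eq {A α} (h : K.src (K.dom α) = A) :
    α ∘₂ K.id₂ (K.id₁ A) = α := by
  subst h; exact K.hcomp₂_id α

@[simp] theorem id₂_hcomp₂_id₂ {g f} (h : K.src g = K.tgt f) :
    K.id₂ g ∘₂ K.id₂ f = K.id₂ (g ∘₁ f) := (K.id₂_hcomp₁ g f h).symm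

@[simp] theorem id₂_hcomp₂_id₂_hcomp₂ {g f α} (h : K.src g = K.tgt f)
    (h' : K.src f = K.tgt (K.dom α)) :
    K.id₂ g ∘₂ K.id₂ f ∘₂ α = K.id₂ (g ∘₁ f) ∘₂ α := by
  rw [K.id₂_hcomp₁ g f h, K.hcomp₂_assoc] <;> simpa

@[simp] theorem id₂_hcomp₂_vcomp {a β α} (h : K.dom β = K.cod α)
    (h' : K.src a = K.tgt (K.dom α)) :
    K.id₂ a ∘₂ (β ⊙ α) = (K.id₂ a ∘₂ β) ⊙ (K.id₂ a ∘₂ α) := by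
  rw [← K.interchange _ _ _ _ (by simp) h (by simpa), K.id_vcomp_of_eq (by simp)]

@[simp] theorem vcomp_hcomp₂_id₂ {a β α} (h : K.dom β = K.cod α)
    (h' : K.src (K.dom α) = K.tgt a) :
    (β ⊙ α) ∘₂ K.id₂ a = (β ∘₂ K.id₂ a) ⊙ (α ∘₂ K.id₂ a) := by
  rw [← K.interchange _ _ _ _ h (by simp) (by simpa), K.id_vcomp_of_eq (by simp)]

/-- Sliding two 2-morphisms past each other. -/
theorem exchange {α β a a' b b'} (ha : K.dom α = a) (ha' : K.cod α = a') (hb : K.dom β = b)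
    (hb' : K.cod β = b') (h : K.src b = K.tgt a) :
    (β ∘₂ K.id₂ a') ⊙ (K.id₂ b ∘₂ α) = (K.id₂ b' ∘₂ α) ⊙ (β ∘₂ K.id₂ a) := by
  subst ha ha' hb hb'
  rw [← K.interchange _ _ _ _ (by simp) (by simp) (by simpa),
    ← K.interchange _ _ _ _ (by simp) (by simp) (by simpa)]
  simp

/-- `exchange` in the middle of a vertical composite. -/
theorem exchange_assoc {α β a a' b b' γ} (ha : K.dom α = a) (ha' : K.cod α = a')
    (hb : K.dom β = b) (hb' : K.cod β = b') (h : K.src b = K.tgt a) (hγ : K.cod γ = b ∘₁ a) :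
    (β ∘₂ K.id₂ a') ⊙ (K.id₂ b ∘₂ α) ⊙ γ = (K.id₂ b' ∘₂ α) ⊙ (β ∘₂ K.id₂ a) ⊙ γ := by
  have h1 : K.src b' = K.src b := by rw [← hb', ← hb, K.src_cod]
  have h2 : K.tgt a' = K.tgt a := by rw [← ha', ← ha, K.tgt_cod]
  rw [← K.vcomp_assoc, K.exchange ha ha' hb hb' h, K.vcomp_assoc] <;> simp [*]

/-- Prolonging an equation between vertical composites of two 2-morphisms. -/
theorem vcomp_eq_assoc {α β α' β' γ} (h : β ⊙ α = K.vcomp β' α') (h1 : K.dom β = K.cod α)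
    (h2 : K.dom α = K.cod γ) (h1' : K.dom β' = K.cod α') (h2' : K.dom α' = K.cod γ) :
    β ⊙ α ⊙ γ = β' ⊙ α' ⊙ γ := by
  rw [← K.vcomp_assoc _ _ _ h1 h2, h, K.vcomp_assoc _ _ _ h1' h2']

theorem vcomp_eq_assoc' {α β δ γ} (h : β ⊙ α = δ) (h1 : K.dom β = K.cod α)
    (h2 : K.dom α = K.cod γ) : β ⊙ α ⊙ γ = K.vcomp δ γ := by
  rw [← K.vcomp_assoc _ _ _ h1 h2, h]

/-- Whiskering distributes over a vertical composite of five 2-morphisms. -/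
theorem id₂_hcomp₂_vcomp_chain {s a b w₁ w₂ w₃ e} (ha : K.dom a = K.cod b)
    (hb : K.dom b = K.cod w₁) (h₁ : K.dom w₁ = K.cod w₂) (h₂ : K.dom w₂ = K.cod w₃)
    (hs : K.src s = K.tgt (K.dom w₃)) (he : K.cod e = s ∘₁ K.dom w₃) :
    (K.id₂ s ∘₂ (a ⊙ b ⊙ w₁ ⊙ w₂ ⊙ w₃)) ⊙ e =
      (K.id₂ s ∘₂ a) ⊙ (K.id₂ s ∘₂ b) ⊙ (K.id₂ s ∘₂ w₁) ⊙ (K.id₂ s ∘₂ w₂) ⊙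
        (K.id₂ s ∘₂ w₃) ⊙ e := by
  have h : ∀ x y, K.dom x = K.cod y → K.tgt (K.dom x) = K.tgt (K.dom y) := fun x y h => by
    rw [h, K.tgt_cod]
  have e₂ := h _ _ h₂
  have e₁ := h _ _ h₁
  have eb := h _ _ hb
  have ea := h _ _ ha
  simp (maxDischargeDepth := 9) [ha, hb, h₁, h₂, hs, he, e₂, e₁, eb, ea]

variable {K}

theorem IsInvertible.id₂ (a) : K.IsInvertible (K.id₂ a) :=
  ⟨K.id₂ a, by simp [IsInverse]⟩

theorem IsInvertible.hcomp₂ {β α} (hβ : K.IsInvertible β) (hα : K.IsInvertible α)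
    (h : K.src (K.dom β) = K.tgt (K.dom α)) : K.IsInvertible (β ∘₂ α) := by
  obtain ⟨β', hd, hc, h1, h2⟩ := hβ
  obtain ⟨α', hd', hc', h1', h2'⟩ := hα
  refine ⟨β' ∘₂ α', by simp (maxDischargeDepth := 9) [*], by simp (maxDischargeDepth := 9) [*],
    ?_, ?_⟩
  · rw [← K.interchange _ _ _ _ hd hd' h, h1, h1']; simp (maxDischargeDepth := 9) [*]
  · rw [← K.interchange _ _ _ _ hc.symm hc'.symm (by simp [*]), h2, h2']
    simp (maxDischargeDepth := 9) [*]

theorem IsInvertible.vcomp {β α} (hβ : K.IsInvertible β) (hα : K.IsInvertible α)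
    (h : K.dom β = K.cod α) : K.IsInvertible (β ⊙ α) := by
  obtain ⟨β', hd, hc, h1, h2⟩ := hβ
  obtain ⟨α', hd', hc', h1', h2'⟩ := hα
  refine ⟨α' ⊙ β', by simp [*], by simp [*], ?_, ?_⟩
  · rw [K.vcomp_assoc, ← K.vcomp_assoc β', h1] <;> simp (maxDischargeDepth := 9) [*]
  · rw [K.vcomp_assoc, ← K.vcomp_assoc α, h2'] <;> simp (maxDischargeDepth := 9) [*]

theorem IsInvertible.inv {α} (h : K.IsInvertible α) : K.IsInvertible (K.inv α) := by
  obtain ⟨hd, hc, h1, h2⟩ := K.inv_isInverse h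
  exact ⟨α, hc.symm, hd.symm, by rw [h2, hd], by rw [h1, hc]⟩

theorem dom_inv {α} (h : K.IsInvertible α) : K.dom (K.inv α) = K.cod α :=
  (K.inv_isInverse h).1

theorem cod_inv {α} (h : K.IsInvertible α) : K.cod (K.inv α) = K.dom α :=
  (K.inv_isInverse h).2.1

theorem inv_vcomp {α} (h : K.IsInvertible α) : K.inv α ⊙ α = K.id₂ (K.dom α) :=
  (K.inv_isInverse h).2.2.1

theorem vcomp_inv {α} (h : K.IsInvertible α) : α ⊙ K.inv α = K.id₂ (K.cod α) :=
  (K.inv_isInverse h).2.2.2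

theorem IsInvertible.cancel_left {α β γ} (h : K.IsInvertible α) (hβ : K.cod β = K.dom α)
    (hγ : K.cod γ = K.dom α) (e : α ⊙ β = K.vcomp α γ) : β = γ := by
  have := congrArg (fun x => K.inv α ⊙ x) e
  rwa [← K.vcomp_assoc _ _ _ (dom_inv h) hβ.symm, ← K.vcomp_assoc _ _ _ (dom_inv h) hγ.symm,
    inv_vcomp h, K.id_vcomp_of_eq hβ, K.id_vcomp_of_eq hγ] at this

/-- Whiskering with a 1-morphism that is isomorphic to an identity is faithful. -/
theorem eq_of_id₂_hcomp₂_eq {t z α β} (h : K.IsInvertible t) (hd : K.dom t = z)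
    (hc : K.cod t = K.id₁ (K.tgt (K.dom α))) (hαβ : K.dom β = K.dom α)
    (hαβ' : K.cod β = K.cod α) (e : K.id₂ z ∘₂ α = K.id₂ z ∘₂ β) : α = β := by
  have hz : K.src z = K.tgt (K.dom α) := by
    rw [← hd, ← K.src_cod, hc, K.src_id₁]
  -- Interchange exhibits γ as the conjugate of 1_z ∘ γ by whiskerings of the isomorphism t, so 1_z
  -- ∘ γ determines γ.
  have key : ∀ γ, K.dom γ = K.dom α → K.cod γ = K.cod α →
      γ ⊙ (t ∘₂ K.id₂ (K.dom α)) = (t ∘₂ K.id₂ (K.cod α)) ⊙ (K.id₂ z ∘₂ γ) := fun γ h1 h2 => by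
    rw [K.exchange h1 h2 hd hc hz, K.id_hcomp₂_of_eq (by rw [h1])]
  have e' := (key α rfl rfl).trans ((congrArg _ e).trans (key β hαβ hαβ').symm)
  have hi : K.IsInvertible (t ∘₂ K.id₂ (K.dom α)) :=
    h.hcomp₂ (IsInvertible.id₂ _) (by simp [*])
  have := congrArg (fun x => x ⊙ K.inv (t ∘₂ K.id₂ (K.dom α))) e'
  rwa [K.vcomp_assoc, K.vcomp_assoc, vcomp_inv hi, K.vcomp_id_of_eq, K.vcomp_id_of_eq] at this
    <;> simp (maxDischargeDepth := 9) [hαβ, hαβ', hc, hd, hz, cod_inv hi]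

end TwoCategory

/-! ### Planar 2-categories: mates of pairings, and traces computed from other duality data. -/

namespace PlanarStructure

variable {K : TwoCategory.{u₀, u₁, u₂}} (P : PlanarStructure K)

attribute [simp] src_star₁ tgt_star₁ dom_star₂ cod_star₂ star₁_id₁ star₂_id₂ star₁_hcomp₁
  star₂_hcomp₂ star₂_vcomp star₁_star₁ star₂_star₂ dom_ε cod_ε

theorem ε_natural' {α a b} (ha : K.dom α = a) (hb : K.cod α = b) :
    (α ∘₂ K.id₂ (P.star₁ a)) ⊙ P.ε a = (K.id₂ b ∘₂ P.star₂ α) ⊙ P.ε b := by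
  subst ha hb; exact P.ε_natural α

/-- The axioms contain one snake identity only; the other one follows from it and the naturality of
ε. The composite e in question is absorbed by ε_a, and an endomorphism of a with this property is
the identity by the first snake identity. -/
theorem ε_snake' (a : K.Cell₁) :
    (P.star₂ (P.ε a) ∘₂ K.id₂ a) ⊙ (K.id₂ a ∘₂ P.ε (P.star₁ a)) = K.id₂ a := by
  set e := (P.star₂ (P.ε a) ∘₂ K.id₂ a) ⊙ (K.id₂ a ∘₂ P.ε (P.star₁ a)) with he
  have hd : K.dom e = a := by simp (maxDischargeDepth := 9) [he]
  have hc : K.cod e = a := by simp (maxDischargeDepth := 9) [he]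
  -- Two copies of ε_a are interchanged, after which the first snake identity applies. Naturality of
  -- ε then moves e* to the other strand, as e.
  have h1 : (K.id₂ a ∘₂ P.star₂ e) ⊙ P.ε a = P.ε a := by
    have h2 := K.exchange (α := P.ε a) (β := P.ε a) (P.dom_ε a) (P.cod_ε a) (P.dom_ε a)
      (P.cod_ε a) (by simp)
    have h3 := congrArg (fun x => x ∘₂ K.id₂ (P.star₁ a)) (P.ε_snake a)
    simp (maxDischargeDepth := 9) at h2 h3
    simp (maxDischargeDepth := 9) [he]
    rw [← h2, ← K.vcomp_assoc, h3] <;> simp (maxDischargeDepth := 9)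
  have h4 : (e ∘₂ K.id₂ (P.star₁ a)) ⊙ P.ε a = P.ε a := by
    rw [P.ε_natural' hd hc, h1]
  have h5 := K.exchange (α := P.star₂ (P.ε (P.star₁ a))) (β := e) rfl rfl rfl rfl
    (by simp [hd])
  have h6 := congrArg (fun x => x ∘₂ K.id₂ a) h4
  simp (maxDischargeDepth := 9) [hd, hc] at h5 h6
  calc e = e ⊙ K.id₂ a := by simp [hd]
    _ = e ⊙ (K.id₂ a ∘₂ P.star₂ (P.ε (P.star₁ a))) ⊙ (P.ε a ∘₂ K.id₂ a) := by rw [P.ε_snake]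
    _ = (K.id₂ a ∘₂ P.star₂ (P.ε (P.star₁ a))) ⊙ (P.ε a ∘₂ K.id₂ a) := by
      rw [← K.vcomp_assoc, h5, K.vcomp_assoc, h6] <;>
        simp (maxDischargeDepth := 9) [hd, hc]
    _ = K.id₂ a := P.ε_snake a

theorem star₂_isInvertible {α} (h : K.IsInvertible α) : K.IsInvertible (P.star₂ α) := by
  obtain ⟨β, hd, hc, h1, h2⟩ := h
  refine ⟨P.star₂ β, by simp [*], by simp [*], ?_, ?_⟩
  · rw [← P.star₂_vcomp _ _ hc.symm, h2]; simp
  · rw [← P.star₂_vcomp _ _ hd, h1]; simp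

/-- The left trace of a 2-endomorphism. -/
def traceL (Φ : K.Cell₂) : K.Cell₂ :=
  P.star₂ (P.ε (K.dom Φ)) ⊙ (Φ ∘₂ K.id₂ (P.star₁ (K.dom Φ))) ⊙ P.ε (K.dom Φ)

/-- The right trace of a 2-endomorphism. -/
def traceR (Φ : K.Cell₂) : K.Cell₂ :=
  P.star₂ (P.ε (P.star₁ (K.dom Φ))) ⊙ (K.id₂ (P.star₁ (K.dom Φ)) ∘₂ Φ) ⊙
    P.ε (P.star₁ (K.dom Φ))

/-- The 2-morphism `b ⇛ a*` associated with a pairing `a ∘ b ⇛ 1`. -/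
def mate (a b : K.Cell₁) (p : K.Cell₂) : K.Cell₂ :=
  (K.id₂ (P.star₁ a) ∘₂ p) ⊙ (P.ε (P.star₁ a) ∘₂ K.id₂ b)

section Mate

variable {P} {a b : K.Cell₁} {p p' g g' Φ : K.Cell₂}

@[simp] theorem dom_mate (h : K.src a = K.tgt b) (hpd : K.dom p = a ∘₁ b) : K.dom (P.mate a b p) = b := by
  simp (maxDischargeDepth := 9) [mate, *]

@[simp] theorem cod_mate (h : K.src a = K.tgt b) (hpd : K.dom p = a ∘₁ b)
    (hpc : K.cod p = K.id₁ (K.tgt a)) :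
    K.cod (P.mate a b p) = P.star₁ a := by
  simp (maxDischargeDepth := 9) [mate, *]

/-- A pairing is recovered from its mate. -/
theorem pairing_eq (h : K.src a = K.tgt b) (hpd : K.dom p = a ∘₁ b)
    (hpc : K.cod p = K.id₁ (K.tgt a)) :
    P.star₂ (P.ε a) ⊙ (K.id₂ a ∘₂ P.mate a b p) = p := by
  have h1 := K.exchange (α := p) (β := P.star₂ (P.ε a)) rfl rfl rfl rfl (by simp [*])
  have h2 := congrArg (fun x => x ∘₂ K.id₂ b) (P.ε_snake' a)
  simp (maxDischargeDepth := 9) [*] at h1 h2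
  simp (maxDischargeDepth := 9) [*, mate]
  rw [← K.vcomp_assoc, h1, K.vcomp_assoc, h2] <;> simp (maxDischargeDepth := 9) [*]

/-- Naturality of ε moves the mate from b to its star on a, so p can also be recovered from the
evaluation of b. -/
theorem pairing_eq' (h : K.src a = K.tgt b) (hpd : K.dom p = a ∘₁ b)
    (hpc : K.cod p = K.id₁ (K.tgt a)) :
    P.star₂ (P.ε (P.star₁ b)) ⊙ (P.star₂ (P.mate a b p) ∘₂ K.id₂ b) = p := by
  have h1 := congrArg P.star₂ (P.ε_natural' (α := P.star₂ (P.mate a b p)) (a := a)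
    (b := P.star₁ b) (by simp [*]) (by simp [*]))
  simp (maxDischargeDepth := 9) [*] at h1
  rw [← h1, pairing_eq h hpd hpc]

/-- Bending the strand b instead of a yields the star of the mate: insert `pairing_eq'` for p and
straighten b* by a snake identity. -/
theorem star₂_mate (h : K.src a = K.tgt b) (hpd : K.dom p = a ∘₁ b)
    (hpc : K.cod p = K.id₁ (K.tgt a)) (h' : K.src b = K.tgt a) :
    (p ∘₂ K.id₂ (P.star₁ b)) ⊙ (K.id₂ a ∘₂ P.ε b) = P.star₂ (P.mate a b p) := by
  have h1 := K.exchange (α := P.ε b) (β := P.star₂ (P.mate a b p)) rfl rfl rfl rfl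
    (by simp [*])
  have h2 := P.ε_snake' (P.star₁ b)
  have h3 : p ∘₂ K.id₂ (P.star₁ b) = _ :=
    congrArg (fun x => x ∘₂ K.id₂ (P.star₁ b)) (pairing_eq' (P := P) h hpd hpc).symm
  simp (maxDischargeDepth := 9) [*] at h1 h2
  rw [h3]
  simp (maxDischargeDepth := 9) [*]
  rw [← K.vcomp_assoc, h2] <;> simp (maxDischargeDepth := 9) [*]

/-- Sliding g past ε_{b*} exposes the snake `hs`. Thus the mate, which identifies a with b*, carries
any copairing dual to p to the canonical one. -/
theorem mate_vcomp_copairing (h : K.src a = K.tgt b) (h' : K.src b = K.tgt a)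
    (hpd : K.dom p = b ∘₁ a)
    (hgd : K.dom g = K.id₁ (K.tgt a)) (hgc : K.cod g = a ∘₁ b)
    (hs : (p ∘₂ K.id₂ b) ⊙ (K.id₂ b ∘₂ g) = K.id₂ b) :
    (P.mate b a p ∘₂ K.id₂ b) ⊙ g = P.ε (P.star₁ b) := by
  have h1 := K.exchange (α := g) (β := P.ε (P.star₁ b)) rfl rfl rfl rfl (by simp [*])
  have h2 := congrArg (fun x => K.id₂ (P.star₁ b) ∘₂ x) hs
  clear hs
  simp (maxDischargeDepth := 9) [*] at h1 h2
  simp (maxDischargeDepth := 9) [*, mate]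
  rw [← K.vcomp_assoc, h2] <;> simp (maxDischargeDepth := 9) [*]

/-- The mirror image of `mate_vcomp_copairing`, with the starred mate expressed through `star₂_mate`
and the opposite snake identity. -/
theorem star₂_mate_vcomp_copairing (h : K.src a = K.tgt b) (h' : K.src b = K.tgt a)
    (hpd : K.dom p = a ∘₁ b) (hpc : K.cod p = K.id₁ (K.tgt a))
    (hgd : K.dom g = K.id₁ (K.tgt b)) (hgc : K.cod g = b ∘₁ a)
    (hs : (K.id₂ b ∘₂ p) ⊙ (g ∘₂ K.id₂ b) = K.id₂ b) :
    (K.id₂ b ∘₂ P.star₂ (P.mate a b p)) ⊙ g = P.ε b := by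
  have h1 := K.exchange (α := P.ε b) (β := g) rfl rfl rfl rfl (by simp [*])
  have h2 := congrArg (fun x => x ∘₂ K.id₂ (P.star₁ b)) hs
  clear hs
  rw [← star₂_mate h hpd hpc h']
  simp (maxDischargeDepth := 9) [*] at h1 h2
  simp (maxDischargeDepth := 9) [*]
  rw [← h1, ← K.vcomp_assoc, h2] <;> simp (maxDischargeDepth := 9) [*]

/-- The pairing p is the canonical one of b preceded by its starred mate, which by `hm` is the mate
of p'. The latter slides past Φ and turns g into ε_{b*}. Without `hm` the mates coming from p and
from g need not agree; this is the abstract content of spatiality. -/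
theorem traceR_eq (h : K.src a = K.tgt b) (h' : K.src b = K.tgt a)
    (hpd : K.dom p = a ∘₁ b) (hpc : K.cod p = K.id₁ (K.tgt a))
    (hpd' : K.dom p' = b ∘₁ a) (hpc' : K.cod p' = K.id₁ (K.tgt b))
    (hgd : K.dom g = K.id₁ (K.tgt a)) (hgc : K.cod g = a ∘₁ b)
    (hs : (p' ∘₂ K.id₂ b) ⊙ (K.id₂ b ∘₂ g) = K.id₂ b)
    (hm : P.mate a b p = P.star₂ (P.mate b a p'))
    (hΦ : K.dom Φ = b) (hΦ' : K.cod Φ = b) :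
    p ⊙ (K.id₂ a ∘₂ Φ) ⊙ g = P.traceR Φ := by
  have h1 := mate_vcomp_copairing (P := P) h h' hpd' hgd hgc hs
  have h2 := K.exchange_assoc (α := Φ) (β := P.mate b a p') (γ := g) rfl rfl rfl rfl
    (by simp [*]) (by simp [*])
  clear hs
  conv_lhs => rw [← pairing_eq' (P := P) h hpd hpc]
  simp (maxDischargeDepth := 9) [*] at h2
  simp (maxDischargeDepth := 9) [h, h', hpd, hpc, hpd', hpc', hgd, hgc, hΦ, hΦ', hm, h2, h1, traceR]

/-- Here the mate of p' is pulled out of p' and slid past Φ; by `hm` it is the starred mate of p,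
which turns g into ε_b. -/
theorem traceL_eq (h : K.src a = K.tgt b) (h' : K.src b = K.tgt a)
    (hpd : K.dom p = a ∘₁ b) (hpc : K.cod p = K.id₁ (K.tgt a))
    (hpd' : K.dom p' = b ∘₁ a) (hpc' : K.cod p' = K.id₁ (K.tgt b))
    (hgd : K.dom g = K.id₁ (K.tgt b)) (hgc : K.cod g = b ∘₁ a)
    (hs : (K.id₂ b ∘₂ p) ⊙ (g ∘₂ K.id₂ b) = K.id₂ b)
    (hm : P.mate a b p = P.star₂ (P.mate b a p'))
    (hΦ : K.dom Φ = b) (hΦ' : K.cod Φ = b) :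
    p' ⊙ (Φ ∘₂ K.id₂ a) ⊙ g = P.traceL Φ := by
  have h1 := star₂_mate_vcomp_copairing (P := P) h h' hpd hpc hgd hgc hs
  rw [hm, P.star₂_star₂] at h1
  have h2 := K.exchange_assoc (α := P.mate b a p') (β := Φ) (γ := g) rfl rfl rfl rfl
    (by simp [*]) (by simp [*])
  clear hs
  conv_lhs => rw [← pairing_eq (P := P) h' hpd' hpc']
  simp (maxDischargeDepth := 9) [*] at h2
  simp (maxDischargeDepth := 9) [h, h', hpd, hpc, hpd', hpc', hgd, hgc, hΦ, hΦ', ← h2, h1, traceL]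

end Mate

end PlanarStructure

/-! ### Gray products with duals: transposition along a fold and its undoing. -/

namespace GrayCategory

section Basic

variable (𝒢 : GrayCategory.{u₀, u₁, u₂, u₃})

attribute [simp] source_tgt target_tgt source_unit target_unit source_box target_box
  src_lbox₁ tgt_lbox₁ dom_lbox₂ cod_lbox₂ lbox₁_id₁ lbox₂_id₂ lbox₁_hcomp₁ lbox₂_hcomp₂
  lbox₂_vcomp src_rbox₁ tgt_rbox₁ dom_rbox₂ cod_rbox₂ rbox₁_id₁ rbox₂_id₂ rbox₁_hcomp₁
  rbox₂_hcomp₂ rbox₂_vcomp box_assoc lbox₁_lbox₁ lbox₁_rbox₁ rbox₁_rbox₁ lbox₂_lbox₂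
  lbox₂_rbox₂ rbox₂_rbox₂ dom_σ cod_σ σ_id_right σ_id_left σ_rbox_left σ_lbox_left
  σ_rbox_right

@[simp] theorem unit_box_of_eq {C F} (h : 𝒢.target F = C) : 𝒢.unit C □₀ F = F := by
  subst h; exact 𝒢.unit_box F

@[simp] theorem box_unit_of_eq {C F} (h : 𝒢.source F = C) : F □₀ 𝒢.unit C = F := by
  subst h; exact 𝒢.box_unit F

@[simp] theorem unit_lbox₁_of_eq {C μ} (h : 𝒢.target (𝒢.src μ) = C) : 𝒢.unit C ◁₁ μ = μ := by
  subst h; exact 𝒢.unit_lbox₁ μ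

@[simp] theorem rbox₁_unit_of_eq {C μ} (h : 𝒢.source (𝒢.src μ) = C) : μ ▷₁ 𝒢.unit C = μ := by
  subst h; exact 𝒢.rbox₁_unit μ

@[simp] theorem unit_lbox₂_of_eq {C Φ} (h : 𝒢.target (𝒢.src (𝒢.dom Φ)) = C) :
    𝒢.unit C ◁₂ Φ = Φ := by
  subst h; exact 𝒢.unit_lbox₂ Φ

@[simp] theorem rbox₂_unit_of_eq {C Φ} (h : 𝒢.source (𝒢.src (𝒢.dom Φ)) = C) :
    Φ ▷₂ 𝒢.unit C = Φ := by
  subst h; exact 𝒢.rbox₂_unit Φ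

theorem σ_natural_right' {μ Φ G₁ G₂ F₁ F₂ ν ν'} (hμ : 𝒢.src μ = G₁) (hμ' : 𝒢.tgt μ = G₂)
    (hd : 𝒢.dom Φ = ν) (hc : 𝒢.cod Φ = ν') (hs : 𝒢.src ν = F₁) (ht : 𝒢.tgt ν = F₂)
    (h : 𝒢.source G₁ = 𝒢.target F₁) :
    𝒢.σ μ ν' ⊙ (𝒢.id₂ (μ ▷₁ F₂) ∘₂ (G₁ ◁₂ Φ)) =
      ((G₂ ◁₂ Φ) ∘₂ 𝒢.id₂ (μ ▷₁ F₁)) ⊙ 𝒢.σ μ ν := by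
  subst hd hc hs ht hμ hμ'; exact 𝒢.σ_natural_right μ Φ h

theorem σ_natural_left' {ν Ψ G₁ G₂ F₁ F₂ μ μ'} (hν : 𝒢.src ν = F₁) (hν' : 𝒢.tgt ν = F₂)
    (hd : 𝒢.dom Ψ = μ) (hc : 𝒢.cod Ψ = μ') (hs : 𝒢.src μ = G₁) (ht : 𝒢.tgt μ = G₂)
    (h : 𝒢.source G₁ = 𝒢.target F₁) :
    𝒢.σ μ' ν ⊙ ((Ψ ▷₂ F₂) ∘₂ 𝒢.id₂ (G₁ ◁₁ ν)) =
      (𝒢.id₂ (G₂ ◁₁ ν) ∘₂ (Ψ ▷₂ F₁)) ⊙ 𝒢.σ μ ν := by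
  subst hd hc hs ht hν hν'; exact 𝒢.σ_natural_left Ψ ν h

end Basic

namespace Duals

variable {𝒢 : GrayCategory.{u₀, u₁, u₂, u₃}} (D : 𝒢.Duals)

attribute [simp] source_sharp target_sharp src_η tgt_η dom_T cod_T sharp_sharp sharp_unit
  η_unit T_unit sharp_box

@[simp] theorem star₁_lbox₁ {G μ} (h : 𝒢.source G = 𝒢.target (𝒢.src μ)) :
    D.star₁ (G ◁₁ μ) = G ◁₁ D.star₁ μ := by
  have := D.star₁_box G μ (𝒢.unit (𝒢.source (𝒢.src μ))) h (by simp)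
  simpa using this

@[simp] theorem star₁_rbox₁ {μ H} (h : 𝒢.source (𝒢.src μ) = 𝒢.target H) :
    D.star₁ (μ ▷₁ H) = D.star₁ μ ▷₁ H := by
  have := D.star₁_box (𝒢.unit (𝒢.target (𝒢.src μ))) μ H (by simp) h
  rwa [𝒢.unit_lbox₁_of_eq (by simp [h]), 𝒢.unit_lbox₁_of_eq (by simp [h])] at this

/-- The transpose `P ⇒ E^#` of a 2-morphism `χ : E □ P ⇒ 1`. -/
def transpose₁ (E P : 𝒢.Hom₁) (χ : 𝒢.Hom₂) : 𝒢.Hom₂ :=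
  (D.sharp E ◁₁ χ) ∘₁ (D.η (D.sharp E) ▷₁ P)

/-- The transpose of a 3-morphism between 2-morphisms `E □ P ⇒ 1`. -/
def transpose₂ (E P : 𝒢.Hom₁) (β : 𝒢.Hom₃) : 𝒢.Hom₃ :=
  (D.sharp E ◁₂ β) ∘₂ 𝒢.id₂ (D.η (D.sharp E) ▷₁ P)

/-- Capping off `F □ α` with the fold of `F`, for a 3-morphism `α` between 2-morphisms with
target `F^#`. -/
def cap (F : 𝒢.Hom₁) (α : 𝒢.Hom₃) : 𝒢.Hom₃ :=
  𝒢.id₂ (D.star₁ (D.η F)) ∘₂ (F ◁₂ α)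

/-- The 3-morphism `η_E^* ∘ (E □ χ^t) ⇛ χ` that removes the transposition of `χ : E □ P ⇒ 1`. -/
def untranspose (E P : 𝒢.Hom₁) (χ : 𝒢.Hom₂) : 𝒢.Hom₃ :=
  (𝒢.id₂ χ ∘₂ (D.T E ▷₂ P)) ⊙
    (𝒢.σ (D.star₁ (D.η E)) χ ∘₂ 𝒢.id₂ (E ◁₁ (D.η (D.sharp E) ▷₁ P)))

/-- The 3-morphism `χ^t ∘ Y ⇛ (χ ∘ (E □ Y))^t` for `χ : E □ P ⇒ 1` and a 2-morphism `Y` with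
target `P`. -/
def slide (E : 𝒢.Hom₁) (χ Y : 𝒢.Hom₂) : 𝒢.Hom₃ :=
  𝒢.id₂ (D.sharp E ◁₁ χ) ∘₂ 𝒢.σ (D.η (D.sharp E)) Y

section

variable {E P P₂ : 𝒢.Hom₁} {χ χ' Y : 𝒢.Hom₂} {β : 𝒢.Hom₃}

/-- β passes the tensorator by naturality in the second argument and the triangulator by
interchange. -/
theorem untranspose_natural (hE : 𝒢.source E = 𝒢.target P) (hs : 𝒢.src χ = E □₀ P)
    (ht : 𝒢.tgt χ = 𝒢.unit (𝒢.target E)) (hd : 𝒢.dom β = χ) (hc : 𝒢.cod β = χ') :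
    D.untranspose E P χ' ⊙ D.cap E (D.transpose₂ E P β) = β ⊙ D.untranspose E P χ := by
  have hs' : 𝒢.src χ' = E □₀ P := by rw [← hc, 𝒢.src_cod, hd, hs]
  have ht' : 𝒢.tgt χ' = 𝒢.unit (𝒢.target E) := by rw [← hc, 𝒢.tgt_cod, hd, ht]
  have h1 := congrArg (fun x => x ∘₂ 𝒢.id₂ (E ◁₁ (D.η (D.sharp E) ▷₁ P)))
    (𝒢.σ_natural_right' (μ := D.star₁ (D.η E)) rfl rfl hd hc hs ht
      (by simp (maxDischargeDepth := 9) [*]))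
  have h2 := 𝒢.exchange (α := D.T E ▷₂ P) (β := β) rfl rfl rfl rfl (by simp (maxDischargeDepth := 9) [*])
  simp (maxDischargeDepth := 9) [*] at h1 h2
  simp (maxDischargeDepth := 9) [*, untranspose, cap, transpose₂]
  rw [← 𝒢.vcomp_eq_assoc h2] <;> simp (maxDischargeDepth := 9) [*]

/-- The hexagon identities collect all tensorators with Y into one for the source of T_E. Naturality
at T_E replaces it by a tensorator of an identity, which is trivial. -/
theorem untranspose_slide (hE : 𝒢.source E = 𝒢.target P) (hs : 𝒢.src χ = E □₀ P)
    (ht : 𝒢.tgt χ = 𝒢.unit (𝒢.target E)) (hYs : 𝒢.src Y = P₂) (hYt : 𝒢.tgt Y = P) :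
    D.untranspose E P₂ (χ ∘₁ (E ◁₁ Y)) ⊙ D.cap E (D.slide E χ Y) =
      D.untranspose E P χ ∘₂ 𝒢.id₂ (E ◁₁ Y) := by
  have hPs : 𝒢.source P₂ = 𝒢.source P := by rw [← hYs, ← hYt, 𝒢.source_tgt]
  have hPt : 𝒢.target P₂ = 𝒢.target P := by rw [← hYs, ← hYt, 𝒢.target_tgt]
  have h1 := 𝒢.σ_hcomp_right (D.star₁ (D.η E)) χ (E ◁₁ Y)
    (by simp (maxDischargeDepth := 9) [*]) (by simp (maxDischargeDepth := 9) [*])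
  have h2 := congrArg (fun x => 𝒢.id₂ χ ∘₂ x) (𝒢.σ_natural_left' (Ψ := D.T E) hYs hYt rfl rfl
    rfl rfl (by simp (maxDischargeDepth := 9) [*]))
  have h3 := 𝒢.σ_hcomp_left (D.star₁ (D.η E) ▷₁ E) (E ◁₁ D.η (D.sharp E)) Y
    (by simp (maxDischargeDepth := 9) [*]) (by simp (maxDischargeDepth := 9) [*])
  have h4 := 𝒢.exchange (α := E ◁₂ 𝒢.σ (D.η (D.sharp E)) Y) (β := 𝒢.σ (D.star₁ (D.η E)) χ)
    rfl rfl rfl rfl (by simp (maxDischargeDepth := 9) [*])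
  simp (maxDischargeDepth := 9) [hE, hs, ht, hYs, hYt, hPs, hPt] at h1 h3
  simp (maxDischargeDepth := 9) [hE, hs, ht, hYs, hYt, hPs, hPt, h3] at h2
  simp (maxDischargeDepth := 9) [hE, hs, ht, hYs, hYt, hPs, hPt] at h4
  simp (maxDischargeDepth := 9) [hE, hs, ht, hYs, hYt, hPs, hPt, untranspose, cap, slide, h1]
  rw [h4, h2, 𝒢.vcomp_assoc, 𝒢.vcomp_assoc] <;>
    simp (maxDischargeDepth := 9) [hE, hs, ht, hYs, hYt, hPs, hPt]

/-- The swallowtail identity. -/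
theorem untranspose_swallowtail (G : 𝒢.Hom₁) :
    D.untranspose G (D.sharp G) (D.star₁ (D.η G)) ⊙ D.cap G (D.star₂ (D.T (D.sharp G))) =
      𝒢.id₂ (D.star₁ (D.η G)) := by
  have h := D.T_swallowtail G
  rw [untranspose, cap, 𝒢.vcomp_assoc, h] <;> simp (maxDischargeDepth := 9)

end

end Duals

end GrayCategory

/-! ### Invertibility of the transposition data, and faithfulness of capping. -/

namespace GrayCategory

open TwoCategory

section Invertible

variable {𝒢 : GrayCategory.{u₀, u₁, u₂, u₃}}

theorem lbox₂_isInvertible {G Φ} (h : 𝒢.IsInvertible Φ)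
    (hG : 𝒢.source G = 𝒢.target (𝒢.src (𝒢.dom Φ))) : 𝒢.IsInvertible (G ◁₂ Φ) := by
  obtain ⟨β, hd, hc, h1, h2⟩ := h
  refine ⟨G ◁₂ β, by simp (maxDischargeDepth := 9) [*], by simp (maxDischargeDepth := 9) [*],
    ?_, ?_⟩
  · rw [← 𝒢.lbox₂_vcomp _ _ _ hG hd, h1]; simp (maxDischargeDepth := 9) [*]
  · rw [← 𝒢.lbox₂_vcomp _ _ _ _ hc.symm, h2] <;> simp (maxDischargeDepth := 9) [*]

theorem rbox₂_isInvertible {G Φ} (h : 𝒢.IsInvertible Φ)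
    (hG : 𝒢.source (𝒢.src (𝒢.dom Φ)) = 𝒢.target G) : 𝒢.IsInvertible (Φ ▷₂ G) := by
  obtain ⟨β, hd, hc, h1, h2⟩ := h
  refine ⟨β ▷₂ G, by simp (maxDischargeDepth := 9) [*], by simp (maxDischargeDepth := 9) [*],
    ?_, ?_⟩
  · rw [← 𝒢.rbox₂_vcomp _ _ _ hG hd, h1]; simp (maxDischargeDepth := 9) [*]
  · rw [← 𝒢.rbox₂_vcomp _ _ _ _ hc.symm, h2] <;> simp (maxDischargeDepth := 9) [*]

end Invertible

namespace Duals

variable {𝒢 : GrayCategory.{u₀, u₁, u₂, u₃}} (D : 𝒢.Duals)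
variable {E F P P₂ : 𝒢.Hom₁} {χ χ' Y : 𝒢.Hom₂} {α β : 𝒢.Hom₃}

theorem untranspose_isInvertible (hE : 𝒢.source E = 𝒢.target P) (hs : 𝒢.src χ = E □₀ P)
    (ht : 𝒢.tgt χ = 𝒢.unit (𝒢.target E)) : 𝒢.IsInvertible (D.untranspose E P χ) := by
  refine ((IsInvertible.id₂ _).hcomp₂ (rbox₂_isInvertible (D.T_invertible E) ?_) ?_).vcomp
    ((𝒢.σ_invertible _ _ ?_).hcomp₂ (IsInvertible.id₂ _) ?_) ?_ <;>
  simp (maxDischargeDepth := 9) [*]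

theorem transpose₂_isInvertible (hE : 𝒢.source E = 𝒢.target P) (hs : 𝒢.src (𝒢.dom β) = E □₀ P)
    (hβ : 𝒢.IsInvertible β) : 𝒢.IsInvertible (D.transpose₂ E P β) := by
  refine (lbox₂_isInvertible hβ ?_).hcomp₂ (IsInvertible.id₂ _) ?_ <;>
  simp (maxDischargeDepth := 9) [*]

theorem slide_isInvertible (hE : 𝒢.source E = 𝒢.target P) (hs : 𝒢.src χ = E □₀ P)
    (hYt : 𝒢.tgt Y = P) : 𝒢.IsInvertible (D.slide E χ Y) := by
  have hPt : 𝒢.target (𝒢.src Y) = 𝒢.target P := by rw [← hYt, 𝒢.target_tgt]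
  refine (IsInvertible.id₂ _).hcomp₂ (𝒢.σ_invertible _ _ ?_) ?_ <;>
  simp (maxDischargeDepth := 9) [*]

@[simp] theorem dom_untranspose (hE : 𝒢.source E = 𝒢.target P) (hs : 𝒢.src χ = E □₀ P)
    (ht : 𝒢.tgt χ = 𝒢.unit (𝒢.target E)) :
    𝒢.dom (D.untranspose E P χ) = D.star₁ (D.η E) ∘₁ (E ◁₁ D.transpose₁ E P χ) := by
  simp (maxDischargeDepth := 9) [untranspose, transpose₁, *]

@[simp] theorem cod_untranspose (hE : 𝒢.source E = 𝒢.target P) (hs : 𝒢.src χ = E □₀ P)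
    (ht : 𝒢.tgt χ = 𝒢.unit (𝒢.target E)) :
    𝒢.cod (D.untranspose E P χ) = χ := by
  simp (maxDischargeDepth := 9) [untranspose, *]

@[simp] theorem src_transpose₁ (hE : 𝒢.source E = 𝒢.target P) (hs : 𝒢.src χ = E □₀ P) :
    𝒢.src (D.transpose₁ E P χ) = P := by
  simp (maxDischargeDepth := 9) [transpose₁, *]

@[simp] theorem tgt_transpose₁ (hE : 𝒢.source E = 𝒢.target P) (hs : 𝒢.src χ = E □₀ P)
    (ht : 𝒢.tgt χ = 𝒢.unit (𝒢.target E)) :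
    𝒢.tgt (D.transpose₁ E P χ) = D.sharp E := by
  simp (maxDischargeDepth := 9) [transpose₁, *]

@[simp] theorem dom_transpose₂ (hE : 𝒢.source E = 𝒢.target P)
    (hs : 𝒢.src (𝒢.dom β) = E □₀ P) :
    𝒢.dom (D.transpose₂ E P β) = D.transpose₁ E P (𝒢.dom β) := by
  simp (maxDischargeDepth := 9) [transpose₂, transpose₁, *]

@[simp] theorem cod_transpose₂ (hE : 𝒢.source E = 𝒢.target P)
    (hs : 𝒢.src (𝒢.dom β) = E □₀ P) :
    𝒢.cod (D.transpose₂ E P β) = D.transpose₁ E P (𝒢.cod β) := by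
  simp (maxDischargeDepth := 9) [transpose₂, transpose₁, *]

theorem dom_slide (hE : 𝒢.source E = 𝒢.target P) (hs : 𝒢.src χ = E □₀ P)
    (hYt : 𝒢.tgt Y = P) :
    𝒢.dom (D.slide E χ Y) = D.transpose₁ E P χ ∘₁ Y := by
  have hPt : 𝒢.target (𝒢.src Y) = 𝒢.target P := by rw [← hYt, 𝒢.target_tgt]
  simp (maxDischargeDepth := 9) [slide, transpose₁, *]

theorem cod_slide (hE : 𝒢.source E = 𝒢.target P) (hs : 𝒢.src χ = E □₀ P)
    (hYs : 𝒢.src Y = P₂) (hYt : 𝒢.tgt Y = P) :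
    𝒢.cod (D.slide E χ Y) = D.transpose₁ E P₂ (χ ∘₁ (E ◁₁ Y)) := by
  have hPt : 𝒢.target P₂ = 𝒢.target P := by rw [← hYs, ← hYt, 𝒢.target_tgt]
  simp (maxDischargeDepth := 9) [slide, transpose₁, *]

@[simp] theorem dom_cap (ht : 𝒢.tgt (𝒢.dom α) = D.sharp F) :
    𝒢.dom (D.cap F α) = D.star₁ (D.η F) ∘₁ (F ◁₁ 𝒢.dom α) := by
  have h1 : 𝒢.target (𝒢.src (𝒢.dom α)) = 𝒢.source F := by
    rw [← 𝒢.target_tgt, ht, D.target_sharp]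
  simp (maxDischargeDepth := 9) [cap, *]

@[simp] theorem cod_cap (ht : 𝒢.tgt (𝒢.dom α) = D.sharp F) :
    𝒢.cod (D.cap F α) = D.star₁ (D.η F) ∘₁ (F ◁₁ 𝒢.cod α) := by
  have h1 : 𝒢.target (𝒢.src (𝒢.dom α)) = 𝒢.source F := by
    rw [← 𝒢.target_tgt, ht, D.target_sharp]
  simp (maxDischargeDepth := 9) [cap, *]

theorem cap_vcomp (ht : 𝒢.tgt (𝒢.dom α) = D.sharp F) (h : 𝒢.dom β = 𝒢.cod α) :
    D.cap F (β ⊙ α) = D.cap F β ⊙ D.cap F α := by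
  have h1 : 𝒢.target (𝒢.src (𝒢.dom α)) = 𝒢.source F := by
    rw [← 𝒢.target_tgt, ht, D.target_sharp]
  simp (maxDischargeDepth := 9) [cap, *]

/-- Folding the cap back with η_{F^#} and sliding α through by the tensorator turns the cap into
whiskering with (F^# □ η_F^*) ∘ (η_{F^#} □ F^#). The starred triangulator of F^# makes this
2-morphism isomorphic to an identity, so the whiskering is faithful. -/
theorem cap_injective (hα : 𝒢.tgt (𝒢.dom α) = D.sharp F) (hd : 𝒢.dom β = 𝒢.dom α)
    (hc : 𝒢.cod β = 𝒢.cod α) (h : D.cap F α = D.cap F β) : α = β := by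
  have h0 : 𝒢.target (𝒢.src (𝒢.dom α)) = 𝒢.source F := by
    rw [← 𝒢.target_tgt, hα, D.target_sharp]
  have h0' : 𝒢.source (𝒢.src (𝒢.dom α)) = 𝒢.target F := by
    rw [← 𝒢.source_tgt, hα, D.source_sharp]
  have hT := D.star₂_isInvertible (D.T_invertible (D.sharp F))
  refine eq_of_id₂_hcomp₂_eq (t := 𝒢.inv (D.star₂ (D.T (D.sharp F)))) hT.inv (dom_inv hT)
    (by rw [cod_inv hT]; simp [hα]) hd hc ?_
  have h1 := fun γ (h1 : 𝒢.dom γ = 𝒢.dom α) (h2 : 𝒢.cod γ = 𝒢.cod α) =>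
    congrArg (fun x => 𝒢.id₂ (D.sharp F ◁₁ D.star₁ (D.η F)) ∘₂ x)
    (𝒢.σ_natural_right' (μ := D.η (D.sharp F)) (Φ := γ) rfl rfl h1 h2 rfl rfl
      (by simp (maxDischargeDepth := 9) [*]))
  have h2 := congrArg (fun x => (D.sharp F ◁₂ x) ∘₂
    𝒢.id₂ (D.η (D.sharp F) ▷₁ 𝒢.src (𝒢.dom α))) h
  have hi : 𝒢.IsInvertible (𝒢.id₂ (D.sharp F ◁₁ D.star₁ (D.η F)) ∘₂
      𝒢.σ (D.η (D.sharp F)) (𝒢.cod α)) := by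
    refine (IsInvertible.id₂ _).hcomp₂ (𝒢.σ_invertible _ _ ?_) ?_ <;>
    simp (maxDischargeDepth := 9) [*]
  have h3 := h1 α rfl rfl
  have h4 := h1 β hd hc
  clear h1 h
  refine hi.cancel_left ?_ ?_ ?_
  · simp (maxDischargeDepth := 9) [h0, h0', hα, hd, hc]
  · simp (maxDischargeDepth := 9) [h0, h0', hα, hd, hc]
  · simp (maxDischargeDepth := 9) [h0, h0', hα, hd, hc, cap] at h2 h3 h4 ⊢
    rw [h3, h4, h2]

end Duals

end GrayCategory

/-! ### The dual of a 2-morphism under capping, and the dual of a composite. -/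

namespace GrayCategory

open TwoCategory

namespace Duals

variable {𝒢 : GrayCategory.{u₀, u₁, u₂, u₃}} (D : 𝒢.Duals)

/-- The 3-morphism `η_F^* ∘ (F □ #ν) ⇛ η_G^* ∘ (ν □ G^#)` for `ν : F ⇒ G`. -/
def unsharp (ν : 𝒢.Hom₂) : 𝒢.Hom₃ :=
  D.untranspose (𝒢.src ν) (D.sharp (𝒢.tgt ν))
    (D.star₁ (D.η (𝒢.tgt ν)) ∘₁ (ν ▷₁ D.sharp (𝒢.tgt ν)))

/-- The 3-morphism `#ρ ∘ #ν ⇛ #(ν ∘ ρ)` for composable 2-morphisms `ν` and `ρ`. -/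
def sharpComp (ν ρ : 𝒢.Hom₂) : 𝒢.Hom₃ :=
  D.transpose₂ (𝒢.src ρ) (D.sharp (𝒢.tgt ν))
    (D.unsharp ν ∘₂ 𝒢.id₂ (ρ ▷₁ D.sharp (𝒢.tgt ν))) ⊙
  D.transpose₂ (𝒢.src ρ) (D.sharp (𝒢.tgt ν))
    (𝒢.id₂ (D.star₁ (D.η (𝒢.src ν))) ∘₂ 𝒢.σ ρ (D.sharp₁ ν)) ⊙
  D.slide (𝒢.src ρ) (D.star₁ (D.η (𝒢.src ν)) ∘₁ (ρ ▷₁ D.sharp (𝒢.src ν))) (D.sharp₁ ν)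

/-- The 3-morphism `η_E^* ∘ (E □ (#ρ ∘ #ν)) ⇛ η_G^* ∘ ((ν ∘ ρ) □ G^#)` for `ρ : E ⇒ F` and
`ν : F ⇒ G`. -/
def unsharpComp (ν ρ : 𝒢.Hom₂) : 𝒢.Hom₃ :=
  (D.unsharp ν ∘₂ 𝒢.id₂ (ρ ▷₁ D.sharp (𝒢.tgt ν))) ⊙
  (𝒢.id₂ (D.star₁ (D.η (𝒢.src ν))) ∘₂ 𝒢.σ ρ (D.sharp₁ ν)) ⊙
  (D.unsharp ρ ∘₂ 𝒢.id₂ (𝒢.src ρ ◁₁ D.sharp₁ ν))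

variable {E F G : 𝒢.Hom₁} {ν ρ : 𝒢.Hom₂}

theorem sharp₁_eq (hs : 𝒢.src ν = F) (ht : 𝒢.tgt ν = G) :
    D.sharp₁ ν = D.transpose₁ F (D.sharp G) (D.star₁ (D.η G) ∘₁ (ν ▷₁ D.sharp G)) := by
  have h1 : 𝒢.source F = 𝒢.source G := by rw [← ht, ← hs, 𝒢.source_tgt]
  have h2 : 𝒢.target F = 𝒢.target G := by rw [← ht, ← hs, 𝒢.target_tgt]
  simp (maxDischargeDepth := 9) [sharp₁, transpose₁, *]

@[simp] theorem src_sharp₁ : 𝒢.src (D.sharp₁ ν) = D.sharp (𝒢.tgt ν) := by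
  rw [D.sharp₁_eq rfl rfl, D.src_transpose₁] <;> simp (maxDischargeDepth := 9)

@[simp] theorem tgt_sharp₁ : 𝒢.tgt (D.sharp₁ ν) = D.sharp (𝒢.src ν) := by
  rw [D.sharp₁_eq rfl rfl, D.tgt_transpose₁] <;> simp (maxDischargeDepth := 9)

@[simp] theorem dom_unsharp (hs : 𝒢.src ν = F) :
    𝒢.dom (D.unsharp ν) = D.star₁ (D.η F) ∘₁ (F ◁₁ D.sharp₁ ν) := by
  rw [D.sharp₁_eq rfl rfl, unsharp, D.dom_untranspose, hs] <;> simp (maxDischargeDepth := 9)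

@[simp] theorem cod_unsharp (ht : 𝒢.tgt ν = G) :
    𝒢.cod (D.unsharp ν) = D.star₁ (D.η G) ∘₁ (ν ▷₁ D.sharp G) := by
  rw [unsharp, D.cod_untranspose, ht] <;> simp (maxDischargeDepth := 9)

theorem unsharp_isInvertible (ν) : 𝒢.IsInvertible (D.unsharp ν) := by
  apply D.untranspose_isInvertible <;> simp (maxDischargeDepth := 9)

theorem dom_sharpComp (hρs : 𝒢.src ρ = E) (hρt : 𝒢.tgt ρ = F) (hνs : 𝒢.src ν = F)
    (hνt : 𝒢.tgt ν = G) : 𝒢.dom (D.sharpComp ν ρ) = D.sharp₁ ρ ∘₁ D.sharp₁ ν := by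
  have h1 : 𝒢.source E = 𝒢.source G := by rw [← hνt, ← hρs, 𝒢.source_tgt, hνs, ← hρt, 𝒢.source_tgt]
  have h2 : 𝒢.target E = 𝒢.target G := by rw [← hνt, ← hρs, 𝒢.target_tgt, hνs, ← hρt, 𝒢.target_tgt]
  have h3 : 𝒢.source F = 𝒢.source G := by rw [← hνt, ← hνs, 𝒢.source_tgt]
  have h4 : 𝒢.target F = 𝒢.target G := by rw [← hνt, ← hνs, 𝒢.target_tgt]
  have h5 := D.dom_slide (E := E) (P := D.sharp F) (Y := D.sharp₁ ν)
    (χ := D.star₁ (D.η F) ∘₁ (ρ ▷₁ D.sharp F)) (by simp [*])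
    (by simp (maxDischargeDepth := 9) [*]) (by simp [*])
  have h6 := D.cod_slide (E := E) (P := D.sharp F) (Y := D.sharp₁ ν) (P₂ := D.sharp G)
    (χ := D.star₁ (D.η F) ∘₁ (ρ ▷₁ D.sharp F)) (by simp [*])
    (by simp (maxDischargeDepth := 9) [*]) (by simp [*]) (by simp [*])
  rw [← D.sharp₁_eq hρs hρt] at h5
  simp (maxDischargeDepth := 9) [*] at h6
  simp (maxDischargeDepth := 9) [sharpComp, *]

theorem cod_sharpComp (hρs : 𝒢.src ρ = E) (hρt : 𝒢.tgt ρ = F) (hνs : 𝒢.src ν = F)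
    (hνt : 𝒢.tgt ν = G) : 𝒢.cod (D.sharpComp ν ρ) = D.sharp₁ (ν ∘₁ ρ) := by
  have h1 : 𝒢.source E = 𝒢.source G := by rw [← hνt, ← hρs, 𝒢.source_tgt, hνs, ← hρt, 𝒢.source_tgt]
  have h2 : 𝒢.target E = 𝒢.target G := by rw [← hνt, ← hρs, 𝒢.target_tgt, hνs, ← hρt, 𝒢.target_tgt]
  have h3 : 𝒢.source F = 𝒢.source G := by rw [← hνt, ← hνs, 𝒢.source_tgt]
  have h4 : 𝒢.target F = 𝒢.target G := by rw [← hνt, ← hνs, 𝒢.target_tgt]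
  have h6 := D.cod_slide (E := E) (P := D.sharp F) (Y := D.sharp₁ ν) (P₂ := D.sharp G)
    (χ := D.star₁ (D.η F) ∘₁ (ρ ▷₁ D.sharp F)) (by simp [*])
    (by simp (maxDischargeDepth := 9) [*]) (by simp [*]) (by simp [*])
  rw [D.sharp₁_eq (F := E) (G := G) (by simp [*]) (by simp [*])]
  simp (maxDischargeDepth := 9) [*] at h6
  simp (maxDischargeDepth := 9) [sharpComp, *]

theorem sharpComp_isInvertible (hρs : 𝒢.src ρ = E) (hρt : 𝒢.tgt ρ = F) (hνs : 𝒢.src ν = F)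
    (hνt : 𝒢.tgt ν = G) : 𝒢.IsInvertible (D.sharpComp ν ρ) := by
  have h1 : 𝒢.source E = 𝒢.source G := by rw [← hνt, ← hρs, 𝒢.source_tgt, hνs, ← hρt, 𝒢.source_tgt]
  have h2 : 𝒢.target E = 𝒢.target G := by rw [← hνt, ← hρs, 𝒢.target_tgt, hνs, ← hρt, 𝒢.target_tgt]
  have h3 : 𝒢.source F = 𝒢.source G := by rw [← hνt, ← hνs, 𝒢.source_tgt]
  have h4 : 𝒢.target F = 𝒢.target G := by rw [← hνt, ← hνs, 𝒢.target_tgt]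
  have h6 := D.cod_slide (E := E) (P := D.sharp F) (Y := D.sharp₁ ν) (P₂ := D.sharp G)
    (χ := D.star₁ (D.η F) ∘₁ (ρ ▷₁ D.sharp F)) (by simp [*])
    (by simp (maxDischargeDepth := 9) [*]) (by simp [*]) (by simp [*])
  simp (maxDischargeDepth := 9) [*] at h6
  refine (D.transpose₂_isInvertible ?_ ?_ ((D.unsharp_isInvertible ν).hcomp₂ (.id₂ _) ?_)).vcomp
    ((D.transpose₂_isInvertible ?_ ?_ ((IsInvertible.id₂ _).hcomp₂ (𝒢.σ_invertible _ _ ?_) ?_)).vcomp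
      (D.slide_isInvertible (P := D.sharp F) ?_ ?_ ?_) ?_) ?_ <;>
  simp (maxDischargeDepth := 9) [*]

/-- `sharpComp` is a slide followed by two transposed 3-morphisms. Untransposition passes the latter
by `untranspose_natural`, which strips their transposition, and then consumes the slide by
`untranspose_slide`. -/
theorem unsharp_vcomp_cap_sharpComp (hρs : 𝒢.src ρ = E) (hρt : 𝒢.tgt ρ = F)
    (hνs : 𝒢.src ν = F) (hνt : 𝒢.tgt ν = G) :
    D.unsharp (ν ∘₁ ρ) ⊙ D.cap E (D.sharpComp ν ρ) = D.unsharpComp ν ρ := by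
  have h1 : 𝒢.source E = 𝒢.source G := by rw [← hνt, ← hρs, 𝒢.source_tgt, hνs, ← hρt, 𝒢.source_tgt]
  have h2 : 𝒢.target E = 𝒢.target G := by rw [← hνt, ← hρs, 𝒢.target_tgt, hνs, ← hρt, 𝒢.target_tgt]
  have h3 : 𝒢.source F = 𝒢.source G := by rw [← hνt, ← hνs, 𝒢.source_tgt]
  have h4 : 𝒢.target F = 𝒢.target G := by rw [← hνt, ← hνs, 𝒢.target_tgt]
  have h6 := D.cod_slide (E := E) (P := D.sharp F) (Y := D.sharp₁ ν) (P₂ := D.sharp G)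
    (χ := D.star₁ (D.η F) ∘₁ (ρ ▷₁ D.sharp F)) (by simp [*])
    (by simp (maxDischargeDepth := 9) [*]) (by simp [*]) (by simp [*])
  have h5 := D.dom_slide (E := E) (P := D.sharp F) (Y := D.sharp₁ ν)
    (χ := D.star₁ (D.η F) ∘₁ (ρ ▷₁ D.sharp F)) (by simp [*])
    (by simp (maxDischargeDepth := 9) [*]) (by simp [*])
  have h7 := D.untranspose_slide (E := E) (P := D.sharp F) (Y := D.sharp₁ ν) (P₂ := D.sharp G)
    (χ := D.star₁ (D.η F) ∘₁ (ρ ▷₁ D.sharp F)) (by simp [*])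
    (by simp (maxDischargeDepth := 9) [*]) (by simp (maxDischargeDepth := 9) [*])
    (by simp [*]) (by simp [*])
  have h8 := D.untranspose_natural (E := E) (P := D.sharp G)
    (β := 𝒢.id₂ (D.star₁ (D.η F)) ∘₂ 𝒢.σ ρ (D.sharp₁ ν)) (by simp [*])
    (χ := D.star₁ (D.η F) ∘₁ (ρ ▷₁ D.sharp F) ∘₁ (E ◁₁ D.sharp₁ ν))
    (χ' := D.star₁ (D.η F) ∘₁ (F ◁₁ D.sharp₁ ν) ∘₁ (ρ ▷₁ D.sharp G))
    (by simp (maxDischargeDepth := 9) [*]) (by simp (maxDischargeDepth := 9) [*])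
    (by simp (maxDischargeDepth := 9) [*]) (by simp (maxDischargeDepth := 9) [*])
  have h9 := D.untranspose_natural (E := E) (P := D.sharp G)
    (β := D.unsharp ν ∘₂ 𝒢.id₂ (ρ ▷₁ D.sharp G)) (by simp [*])
    (χ := D.star₁ (D.η F) ∘₁ (F ◁₁ D.sharp₁ ν) ∘₁ (ρ ▷₁ D.sharp G))
    (χ' := D.star₁ (D.η G) ∘₁ ((ν ∘₁ ρ) ▷₁ D.sharp G))
    (by simp (maxDischargeDepth := 9) [*]) (by simp (maxDischargeDepth := 9) [*])
    (by simp (maxDischargeDepth := 9) [*]) (by simp (maxDischargeDepth := 9) [*])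
  have h10 : D.unsharp (ν ∘₁ ρ) =
      D.untranspose E (D.sharp G) (D.star₁ (D.η G) ∘₁ ((ν ∘₁ ρ) ▷₁ D.sharp G)) := by
    simp [unsharp, *]
  have h11 : D.unsharp ρ =
      D.untranspose E (D.sharp F) (D.star₁ (D.η F) ∘₁ (ρ ▷₁ D.sharp F)) := by
    simp [unsharp, *]
  rw [𝒢.hcomp₁_assoc _ _ _ (by simp (maxDischargeDepth := 9) [*])
    (by simp (maxDischargeDepth := 9) [*])] at h6 h7
  rw [← D.sharp₁_eq hρs hρt] at h5
  rw [h10, sharpComp, unsharpComp, hρs, hνt, hνs, h11, ← h7, D.cap_vcomp, D.cap_vcomp,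
    𝒢.vcomp_eq_assoc h9, 𝒢.vcomp_eq_assoc h8] <;>
  clear h7 h8 h9 h10 h11 <;>
  simp (maxDischargeDepth := 9) [*]

end Duals

end GrayCategory

/-! ### Naturality of unsharping, and triple composites. -/

namespace GrayCategory

open TwoCategory

namespace Duals

variable {𝒢 : GrayCategory.{u₀, u₁, u₂, u₃}} (D : 𝒢.Duals)
variable {E F G P : 𝒢.Hom₁} {μ ν ν' ρ ρ' Y Y' : 𝒢.Hom₂} {Φ y : 𝒢.Hom₃}

theorem sharp₂_eq (hd : 𝒢.dom Φ = ν) (hs : 𝒢.src ν = F) (ht : 𝒢.tgt ν = G) :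
    D.sharp₂ Φ = D.transpose₂ F (D.sharp G) (𝒢.id₂ (D.star₁ (D.η G)) ∘₂ (Φ ▷₂ D.sharp G)) := by
  have h1 : 𝒢.source F = 𝒢.source G := by rw [← ht, ← hs, 𝒢.source_tgt]
  have h2 : 𝒢.target F = 𝒢.target G := by rw [← ht, ← hs, 𝒢.target_tgt]
  simp (maxDischargeDepth := 9) [sharp₂, transpose₂, *]

@[simp] theorem dom_sharp₂ : 𝒢.dom (D.sharp₂ Φ) = D.sharp₁ (𝒢.dom Φ) := by
  rw [D.sharp₂_eq rfl rfl rfl, D.sharp₁_eq rfl rfl, D.dom_transpose₂] <;>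
    simp (maxDischargeDepth := 9)

@[simp] theorem cod_sharp₂ : 𝒢.cod (D.sharp₂ Φ) = D.sharp₁ (𝒢.cod Φ) := by
  rw [D.sharp₂_eq rfl rfl rfl, D.sharp₁_eq (𝒢.src_cod _) (𝒢.tgt_cod _), D.cod_transpose₂] <;>
    simp (maxDischargeDepth := 9)

/-- #Φ is the transpose of 1_{η_G^*} ∘ (Φ □ G^#), so this is an instance of `untranspose_natural`.
-/
theorem unsharp_natural (hd : 𝒢.dom Φ = ν) (hc : 𝒢.cod Φ = ν') (hs : 𝒢.src ν = F)
    (ht : 𝒢.tgt ν = G) :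
    D.unsharp ν' ⊙ D.cap F (D.sharp₂ Φ) =
      (𝒢.id₂ (D.star₁ (D.η G)) ∘₂ (Φ ▷₂ D.sharp G)) ⊙ D.unsharp ν := by
  have h1 : 𝒢.source F = 𝒢.source G := by rw [← ht, ← hs, 𝒢.source_tgt]
  have h2 : 𝒢.target F = 𝒢.target G := by rw [← ht, ← hs, 𝒢.target_tgt]
  have hs' : 𝒢.src ν' = F := by rw [← hc, 𝒢.src_cod, hd, hs]
  have ht' : 𝒢.tgt ν' = G := by rw [← hc, 𝒢.tgt_cod, hd, ht]
  rw [D.sharp₂_eq hd hs ht, unsharp, unsharp, hs, ht, hs', ht', D.untranspose_natural] <;>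
    simp (maxDischargeDepth := 9) [*]

/-- The 3-morphism `η_F^* ∘ (F □ #μ) ∘ (F □ Y) ⇛ η_G^* ∘ (G □ Y) ∘ (μ □ P)` for `μ : F ⇒ G` and
`Y : P ⇒ G^#`. -/
def unsharpPast (μ Y : 𝒢.Hom₂) : 𝒢.Hom₃ :=
  (𝒢.id₂ (D.star₁ (D.η (𝒢.tgt μ))) ∘₂ 𝒢.σ μ Y) ⊙ (D.unsharp μ ∘₂ 𝒢.id₂ (𝒢.src μ ◁₁ Y))

/-- The 3-morphism `η_F^* ∘ (ρ □ F^#) ∘ (E □ #μ) ⇛ η_G^* ∘ (μ □ G^#) ∘ (ρ □ G^#)` for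
`ρ : E ⇒ F` and `μ : F ⇒ G`. -/
def unsharpUnder (μ ρ : 𝒢.Hom₂) : 𝒢.Hom₃ :=
  (D.unsharp μ ∘₂ 𝒢.id₂ (ρ ▷₁ D.sharp (𝒢.tgt μ))) ⊙
    (𝒢.id₂ (D.star₁ (D.η (𝒢.src μ))) ∘₂ 𝒢.σ ρ (D.sharp₁ μ))

@[simp] theorem dom_unsharpUnder (hρs : 𝒢.src ρ = E) (hρt : 𝒢.tgt ρ = F) (hνs : 𝒢.src ν = F)
    (hνt : 𝒢.tgt ν = G) :
    𝒢.dom (D.unsharpUnder ν ρ) =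
      D.star₁ (D.η F) ∘₁ (ρ ▷₁ D.sharp F) ∘₁ (E ◁₁ D.sharp₁ ν) := by
  have h1 : 𝒢.source E = 𝒢.source G := by rw [← hνt, ← hρs, 𝒢.source_tgt, hνs, ← hρt, 𝒢.source_tgt]
  have h2 : 𝒢.target E = 𝒢.target G := by rw [← hνt, ← hρs, 𝒢.target_tgt, hνs, ← hρt, 𝒢.target_tgt]
  have h3 : 𝒢.source F = 𝒢.source G := by rw [← hνt, ← hνs, 𝒢.source_tgt]
  have h4 : 𝒢.target F = 𝒢.target G := by rw [← hνt, ← hνs, 𝒢.target_tgt]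
  simp (maxDischargeDepth := 9) [unsharpUnder, *]

@[simp] theorem cod_unsharpUnder (hρs : 𝒢.src ρ = E) (hρt : 𝒢.tgt ρ = F) (hνs : 𝒢.src ν = F)
    (hνt : 𝒢.tgt ν = G) :
    𝒢.cod (D.unsharpUnder ν ρ) =
      D.star₁ (D.η G) ∘₁ (ν ▷₁ D.sharp G) ∘₁ (ρ ▷₁ D.sharp G) := by
  have h1 : 𝒢.source E = 𝒢.source G := by rw [← hνt, ← hρs, 𝒢.source_tgt, hνs, ← hρt, 𝒢.source_tgt]
  have h2 : 𝒢.target E = 𝒢.target G := by rw [← hνt, ← hρs, 𝒢.target_tgt, hνs, ← hρt, 𝒢.target_tgt]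
  have h3 : 𝒢.source F = 𝒢.source G := by rw [← hνt, ← hνs, 𝒢.source_tgt]
  have h4 : 𝒢.target F = 𝒢.target G := by rw [← hνt, ← hνs, 𝒢.target_tgt]
  simp (maxDischargeDepth := 9) [unsharpUnder, *]

@[simp] theorem dom_unsharpComp (hρs : 𝒢.src ρ = E) (hρt : 𝒢.tgt ρ = F) (hνs : 𝒢.src ν = F)
    (hνt : 𝒢.tgt ν = G) :
    𝒢.dom (D.unsharpComp ν ρ) =
      D.star₁ (D.η E) ∘₁ (E ◁₁ D.sharp₁ ρ) ∘₁ (E ◁₁ D.sharp₁ ν) := by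
  have h1 : 𝒢.source E = 𝒢.source G := by rw [← hνt, ← hρs, 𝒢.source_tgt, hνs, ← hρt, 𝒢.source_tgt]
  have h2 : 𝒢.target E = 𝒢.target G := by rw [← hνt, ← hρs, 𝒢.target_tgt, hνs, ← hρt, 𝒢.target_tgt]
  have h3 : 𝒢.source F = 𝒢.source G := by rw [← hνt, ← hνs, 𝒢.source_tgt]
  have h4 : 𝒢.target F = 𝒢.target G := by rw [← hνt, ← hνs, 𝒢.target_tgt]
  simp (maxDischargeDepth := 9) [unsharpComp, *]

@[simp] theorem cod_unsharpComp (hρs : 𝒢.src ρ = E) (hρt : 𝒢.tgt ρ = F) (hνs : 𝒢.src ν = F)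
    (hνt : 𝒢.tgt ν = G) :
    𝒢.cod (D.unsharpComp ν ρ) =
      D.star₁ (D.η G) ∘₁ (ν ▷₁ D.sharp G) ∘₁ (ρ ▷₁ D.sharp G) := by
  have h1 : 𝒢.source E = 𝒢.source G := by rw [← hνt, ← hρs, 𝒢.source_tgt, hνs, ← hρt, 𝒢.source_tgt]
  have h2 : 𝒢.target E = 𝒢.target G := by rw [← hνt, ← hρs, 𝒢.target_tgt, hνs, ← hρt, 𝒢.target_tgt]
  have h3 : 𝒢.source F = 𝒢.source G := by rw [← hνt, ← hνs, 𝒢.source_tgt]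
  have h4 : 𝒢.target F = 𝒢.target G := by rw [← hνt, ← hνs, 𝒢.target_tgt]
  simp (maxDischargeDepth := 9) [unsharpComp, *]

@[simp] theorem dom_unsharpPast (hs : 𝒢.src μ = F) (ht : 𝒢.tgt μ = G) (hYs : 𝒢.src Y = P)
    (hYt : 𝒢.tgt Y = D.sharp G) :
    𝒢.dom (D.unsharpPast μ Y) =
      D.star₁ (D.η F) ∘₁ (F ◁₁ D.sharp₁ μ) ∘₁ (F ◁₁ Y) := by
  have h1 : 𝒢.source F = 𝒢.source G := by rw [← ht, ← hs, 𝒢.source_tgt]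
  have h2 : 𝒢.target F = 𝒢.target G := by rw [← ht, ← hs, 𝒢.target_tgt]
  have h3 : 𝒢.source P = 𝒢.target G := by rw [← hYs, ← 𝒢.source_tgt, hYt, D.source_sharp]
  have h4 : 𝒢.target P = 𝒢.source G := by rw [← hYs, ← 𝒢.target_tgt, hYt, D.target_sharp]
  simp (maxDischargeDepth := 9) [unsharpPast, *]

@[simp] theorem cod_unsharpPast (hs : 𝒢.src μ = F) (ht : 𝒢.tgt μ = G) (hYs : 𝒢.src Y = P)
    (hYt : 𝒢.tgt Y = D.sharp G) :
    𝒢.cod (D.unsharpPast μ Y) =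
      D.star₁ (D.η G) ∘₁ (G ◁₁ Y) ∘₁ (μ ▷₁ P) := by
  have h1 : 𝒢.source F = 𝒢.source G := by rw [← ht, ← hs, 𝒢.source_tgt]
  have h2 : 𝒢.target F = 𝒢.target G := by rw [← ht, ← hs, 𝒢.target_tgt]
  have h3 : 𝒢.source P = 𝒢.target G := by rw [← hYs, ← 𝒢.source_tgt, hYt, D.source_sharp]
  have h4 : 𝒢.target P = 𝒢.source G := by rw [← hYs, ← 𝒢.target_tgt, hYt, D.target_sharp]
  simp (maxDischargeDepth := 9) [unsharpPast, *]

theorem unsharpPast_natural (hs : 𝒢.src μ = F) (ht : 𝒢.tgt μ = G) (hd : 𝒢.dom y = Y)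
    (hc : 𝒢.cod y = Y') (hYs : 𝒢.src Y = P) (hYt : 𝒢.tgt Y = D.sharp G) :
    D.unsharpPast μ Y' ⊙ (𝒢.id₂ (D.star₁ (D.η F) ∘₁ (F ◁₁ D.sharp₁ μ)) ∘₂ (F ◁₂ y)) =
      (𝒢.id₂ (D.star₁ (D.η G)) ∘₂ (G ◁₂ y) ∘₂ 𝒢.id₂ (μ ▷₁ P)) ⊙ D.unsharpPast μ Y := by
  have h1 : 𝒢.source F = 𝒢.source G := by rw [← ht, ← hs, 𝒢.source_tgt]
  have h2 : 𝒢.target F = 𝒢.target G := by rw [← ht, ← hs, 𝒢.target_tgt]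
  have h3 : 𝒢.source P = 𝒢.target G := by rw [← hYs, ← 𝒢.source_tgt, hYt, D.source_sharp]
  have h4 : 𝒢.target P = 𝒢.source G := by rw [← hYs, ← 𝒢.target_tgt, hYt, D.target_sharp]
  have hYs' : 𝒢.src Y' = P := by rw [← hc, 𝒢.src_cod, hd, hYs]
  have hYt' : 𝒢.tgt Y' = D.sharp G := by rw [← hc, 𝒢.tgt_cod, hd, hYt]
  have e1 := congrArg (fun x => 𝒢.id₂ (D.star₁ (D.η G)) ∘₂ x)
    (𝒢.σ_natural_right' (μ := μ) hs ht hd hc hYs hYt (by simp [*]))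
  have e2 := 𝒢.exchange (α := F ◁₂ y) (β := D.unsharp μ) rfl rfl rfl rfl
    (by simp (maxDischargeDepth := 9) [*])
  simp (maxDischargeDepth := 9) [h1, h2, h3, h4, hYs, hYs', hYt, hYt', hs, ht, hd, hc] at e1 e2
  simp (maxDischargeDepth := 9)
    [h1, h2, h3, h4, hYs, hYs', hYt, hYt', hs, ht, hd, hc, unsharpPast]
  rw [e2, 𝒢.vcomp_eq_assoc e1] <;>
  simp (maxDischargeDepth := 9) [h1, h2, h3, h4, hYs, hYs', hYt, hYt', hs, ht, hd, hc]

theorem unsharpUnder_natural (hs : 𝒢.src μ = F) (ht : 𝒢.tgt μ = G) (hd : 𝒢.dom Φ = ρ)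
    (hc : 𝒢.cod Φ = ρ') (hρs : 𝒢.src ρ = E) (hρt : 𝒢.tgt ρ = F) :
    D.unsharpUnder μ ρ' ⊙
        (𝒢.id₂ (D.star₁ (D.η F)) ∘₂ (Φ ▷₂ D.sharp F) ∘₂ 𝒢.id₂ (E ◁₁ D.sharp₁ μ)) =
      (𝒢.id₂ (D.star₁ (D.η G) ∘₁ (μ ▷₁ D.sharp G)) ∘₂ (Φ ▷₂ D.sharp G)) ⊙
        D.unsharpUnder μ ρ := by
  have h1 : 𝒢.source F = 𝒢.source G := by rw [← ht, ← hs, 𝒢.source_tgt]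
  have h2 : 𝒢.target F = 𝒢.target G := by rw [← ht, ← hs, 𝒢.target_tgt]
  have h3 : 𝒢.source E = 𝒢.source G := by rw [← hρs, ← 𝒢.source_tgt, hρt, h1]
  have h4 : 𝒢.target E = 𝒢.target G := by rw [← hρs, ← 𝒢.target_tgt, hρt, h2]
  have hρs' : 𝒢.src ρ' = E := by rw [← hc, 𝒢.src_cod, hd, hρs]
  have hρt' : 𝒢.tgt ρ' = F := by rw [← hc, 𝒢.tgt_cod, hd, hρt]
  have e1 := congrArg (fun x => 𝒢.id₂ (D.star₁ (D.η F)) ∘₂ x)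
    (𝒢.σ_natural_left' (ν := D.sharp₁ μ) rfl rfl hd hc hρs hρt (by simp [*]))
  have e2 := 𝒢.exchange (α := Φ ▷₂ D.sharp G) (β := D.unsharp μ) rfl rfl rfl rfl
    (by simp (maxDischargeDepth := 9) [*])
  simp (maxDischargeDepth := 9) [h1, h2, h3, h4, hρs, hρs', hρt, hρt', hs, ht, hd, hc] at e1 e2
  simp (maxDischargeDepth := 9)
    [h1, h2, h3, h4, hρs, hρs', hρt, hρt', hs, ht, hd, hc, unsharpUnder]
  rw [e1, 𝒢.vcomp_eq_assoc e2] <;>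
  simp (maxDischargeDepth := 9) [h1, h2, h3, h4, hρs, hρs', hρt, hρt', hs, ht, hd, hc]

/-- Tensorators with an identity are trivial. This case and `unsharpUnder_id₁` handle the two ends
of a snake, where only a single #μ is left. -/
theorem unsharpPast_id₁ (ht : 𝒢.tgt μ = G) :
    D.unsharpPast μ (𝒢.id₁ (D.sharp G)) = D.unsharp μ := by
  have h1 : 𝒢.source (𝒢.src μ) = 𝒢.source G := by rw [← ht, 𝒢.source_tgt]
  have h2 : 𝒢.target (𝒢.src μ) = 𝒢.target G := by rw [← ht, 𝒢.target_tgt]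
  simp (maxDischargeDepth := 9) [unsharpPast, *]

theorem unsharpUnder_id₁ (hs : 𝒢.src μ = F) :
    D.unsharpUnder μ (𝒢.id₁ F) = D.unsharp μ := by
  obtain ⟨G, ht⟩ : ∃ G, 𝒢.tgt μ = G := ⟨_, rfl⟩
  have h1 : 𝒢.source F = 𝒢.source G := by rw [← ht, ← hs, 𝒢.source_tgt]
  have h2 : 𝒢.target F = 𝒢.target G := by rw [← ht, ← hs, 𝒢.target_tgt]
  simp (maxDischargeDepth := 9) [unsharpUnder, *]

/-- #Φ first slides past the unsharped ρ and is then unsharped itself. Since # reverses ∘, it acts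
on the right factor before and on the left factor after. -/
theorem unsharpComp_natural_left (hρs : 𝒢.src ρ = E) (hρt : 𝒢.tgt ρ = F)
    (hνs : 𝒢.src ν = F) (hνt : 𝒢.tgt ν = G) (hd : 𝒢.dom Φ = ν) (hc : 𝒢.cod Φ = ν') :
    D.unsharpComp ν' ρ ⊙ D.cap E (𝒢.id₂ (D.sharp₁ ρ) ∘₂ D.sharp₂ Φ) =
      (𝒢.id₂ (D.star₁ (D.η G)) ∘₂ ((Φ ∘₂ 𝒢.id₂ ρ) ▷₂ D.sharp G)) ⊙ D.unsharpComp ν ρ := by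
  have h1 : 𝒢.source E = 𝒢.source G := by rw [← hνt, ← hρs, 𝒢.source_tgt, hνs, ← hρt, 𝒢.source_tgt]
  have h2 : 𝒢.target E = 𝒢.target G := by rw [← hνt, ← hρs, 𝒢.target_tgt, hνs, ← hρt, 𝒢.target_tgt]
  have h3 : 𝒢.source F = 𝒢.source G := by rw [← hνt, ← hνs, 𝒢.source_tgt]
  have h4 : 𝒢.target F = 𝒢.target G := by rw [← hνt, ← hνs, 𝒢.target_tgt]
  have hνs' : 𝒢.src ν' = F := by rw [← hc, 𝒢.src_cod, hd, hνs]
  have hνt' : 𝒢.tgt ν' = G := by rw [← hc, 𝒢.tgt_cod, hd, hνt]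
  have e1 := D.unsharpPast_natural (y := D.sharp₂ Φ) hρs hρt rfl rfl rfl (by simp [*])
  have e2 := congrArg (fun x => x ∘₂ 𝒢.id₂ (ρ ▷₁ D.sharp G)) (D.unsharp_natural hd hc hνs hνt)
  simp (maxDischargeDepth := 9)
    [h1, h2, h3, h4, hρs, hρt, hνs, hνt, hνs', hνt', hd, hc, unsharpPast] at e1
  simp (maxDischargeDepth := 9)
    [h1, h2, h3, h4, hρs, hρt, hνs, hνt, hνs', hνt', hd, hc, cap] at e2
  simp (maxDischargeDepth := 9)
    [h1, h2, h3, h4, hρs, hρt, hνs, hνt, hνs', hνt', hd, hc, unsharpComp, cap]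
  rw [e1, 𝒢.vcomp_eq_assoc e2] <;>
  simp (maxDischargeDepth := 9) [h1, h2, h3, h4, hρs, hρt, hνs, hνt, hνs', hνt', hd, hc]

/-- Here #Φ is unsharped at once, and Φ then passes below the remaining #ν by naturality of the
tensorator in its first argument. -/
theorem unsharpComp_natural_right (hρs : 𝒢.src ρ = E) (hρt : 𝒢.tgt ρ = F)
    (hνs : 𝒢.src ν = F) (hνt : 𝒢.tgt ν = G) (hd : 𝒢.dom Φ = ρ) (hc : 𝒢.cod Φ = ρ') :
    D.unsharpComp ν ρ' ⊙ D.cap E (D.sharp₂ Φ ∘₂ 𝒢.id₂ (D.sharp₁ ν)) =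
      (𝒢.id₂ (D.star₁ (D.η G)) ∘₂ ((𝒢.id₂ ν ∘₂ Φ) ▷₂ D.sharp G)) ⊙ D.unsharpComp ν ρ := by
  have h1 : 𝒢.source E = 𝒢.source G := by rw [← hνt, ← hρs, 𝒢.source_tgt, hνs, ← hρt, 𝒢.source_tgt]
  have h2 : 𝒢.target E = 𝒢.target G := by rw [← hνt, ← hρs, 𝒢.target_tgt, hνs, ← hρt, 𝒢.target_tgt]
  have h3 : 𝒢.source F = 𝒢.source G := by rw [← hνt, ← hνs, 𝒢.source_tgt]
  have h4 : 𝒢.target F = 𝒢.target G := by rw [← hνt, ← hνs, 𝒢.target_tgt]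
  have hρs' : 𝒢.src ρ' = E := by rw [← hc, 𝒢.src_cod, hd, hρs]
  have hρt' : 𝒢.tgt ρ' = F := by rw [← hc, 𝒢.tgt_cod, hd, hρt]
  have e1 := D.unsharpUnder_natural hνs hνt hd hc hρs hρt
  have e2 := congrArg (fun x => x ∘₂ 𝒢.id₂ (E ◁₁ D.sharp₁ ν)) (D.unsharp_natural hd hc hρs hρt)
  simp (maxDischargeDepth := 9)
    [h1, h2, h3, h4, hρs, hρt, hνs, hνt, hρs', hρt', hd, hc, unsharpUnder] at e1
  simp (maxDischargeDepth := 9)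
    [h1, h2, h3, h4, hρs, hρt, hνs, hνt, hρs', hρt', hd, hc, cap] at e2
  simp (maxDischargeDepth := 9)
    [h1, h2, h3, h4, hρs, hρt, hνs, hνt, hρs', hρt', hd, hc, unsharpComp, cap]
  have e3 := congrArg (fun x => x ⊙ (D.unsharp ρ ∘₂ 𝒢.id₂ (E ◁₁ D.sharp₁ ν))) e1
  simp (maxDischargeDepth := 9)
    [h1, h2, h3, h4, hρs, hρt, hνs, hνt, hρs', hρt', hd, hc] at e3
  rw [e2, e3]

/-- Both ways of resolving `#μ ∘ #ν ∘ #μ` agree. -/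
theorem unsharpComp_unsharpComp (hs : 𝒢.src μ = F) (ht : 𝒢.tgt μ = G) (hνs : 𝒢.src ν = G)
    (hνt : 𝒢.tgt ν = F) :
    (D.unsharpComp μ ν ∘₂ 𝒢.id₂ (μ ▷₁ D.sharp G)) ⊙
        D.unsharpPast μ (D.sharp₁ ν ∘₁ D.sharp₁ μ) =
      D.unsharpUnder μ (ν ∘₁ μ) ⊙ (D.unsharpComp ν μ ∘₂ 𝒢.id₂ (F ◁₁ D.sharp₁ μ)) := by
  have h1 : 𝒢.source F = 𝒢.source G := by rw [← ht, ← hs, 𝒢.source_tgt]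
  have h2 : 𝒢.target F = 𝒢.target G := by rw [← ht, ← hs, 𝒢.target_tgt]
  have e1 := 𝒢.σ_hcomp_right μ (D.sharp₁ ν) (D.sharp₁ μ) (by simp [*]) (by simp [*])
  -- Once both composite tensorators are split by the hexagon identities, the two sides differ only
  -- in the order of σ_{μ,#μ} and the unsharping of ν, which act on disjoint strands.
  have e2 := 𝒢.σ_hcomp_left ν μ (D.sharp₁ μ) (by simp [*]) (by simp [*])
  have e3 := 𝒢.exchange (α := 𝒢.σ μ (D.sharp₁ μ)) (β := D.unsharp ν) rfl rfl rfl rfl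
    (by simp (maxDischargeDepth := 9) [*])
  simp (maxDischargeDepth := 9) [h1, h2, hs, ht, hνs, hνt] at e3
  simp (maxDischargeDepth := 9) [h1, h2, hs, ht, hνs, hνt, e1, e2, unsharpComp, unsharpPast,
    unsharpUnder]
  rw [𝒢.vcomp_eq_assoc e3] <;> simp (maxDischargeDepth := 9) [h1, h2, hs, ht, hνs, hνt]

end Duals

end GrayCategory

/-! ### The duality between #ν and #ν* induced by ε. -/

namespace GrayCategory

open TwoCategory

namespace Duals

variable {𝒢 : GrayCategory.{u₀, u₁, u₂, u₃}} (D : 𝒢.Duals)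
variable {E F G P : 𝒢.Hom₁} {μ ν n : 𝒢.Hom₂} {Φ : 𝒢.Hom₃}

/-- The pairing `#ν* ∘ #ν ⇛ 1` induced by `ε_ν^*`. -/
noncomputable def pairing (ν : 𝒢.Hom₂) : 𝒢.Hom₃ :=
  𝒢.inv (D.star₂ (D.T (D.sharp (𝒢.tgt ν)))) ⊙ D.sharp₂ (D.star₂ (D.ε ν)) ⊙
    D.sharpComp ν (D.star₁ ν)

/-- The copairing `1 ⇛ #ν* ∘ #ν` induced by `ε_ν`. -/
noncomputable def copairing (ν : 𝒢.Hom₂) : 𝒢.Hom₃ :=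
  𝒢.inv (D.sharpComp ν (D.star₁ ν)) ⊙ D.sharp₂ (D.ε ν) ⊙
    D.star₂ (D.T (D.sharp (𝒢.tgt ν)))

theorem star₂_T_isInvertible (F : 𝒢.Hom₁) : 𝒢.IsInvertible (D.star₂ (D.T F)) :=
  D.star₂_isInvertible (D.T_invertible F)

theorem sharp₁_id₁ (G : 𝒢.Hom₁) :
    D.sharp₁ (𝒢.id₁ G) = (D.sharp G ◁₁ D.star₁ (D.η G)) ∘₁ (D.η (D.sharp G) ▷₁ D.sharp G) := by
  simp (maxDischargeDepth := 9) [sharp₁]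

theorem sharpComp_star_isInvertible (ν) : 𝒢.IsInvertible (D.sharpComp ν (D.star₁ ν)) :=
  D.sharpComp_isInvertible rfl (by simp) rfl rfl

theorem dom_sharpComp_star (ν) :
    𝒢.dom (D.sharpComp ν (D.star₁ ν)) = D.sharp₁ (D.star₁ ν) ∘₁ D.sharp₁ ν :=
  D.dom_sharpComp rfl (by simp) rfl rfl

theorem cod_sharpComp_star (ν) :
    𝒢.cod (D.sharpComp ν (D.star₁ ν)) = D.sharp₁ (ν ∘₁ D.star₁ ν) :=
  D.cod_sharpComp rfl (by simp) rfl rfl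

@[simp] theorem dom_pairing : 𝒢.dom (D.pairing ν) = D.sharp₁ (D.star₁ ν) ∘₁ D.sharp₁ ν := by
  have h := D.star₂_T_isInvertible (D.sharp (𝒢.tgt ν))
  simp (maxDischargeDepth := 9) [pairing, dom_sharpComp_star, cod_sharpComp_star, dom_inv h,
    sharp₁_id₁]

@[simp] theorem cod_pairing (ht : 𝒢.tgt ν = G) : 𝒢.cod (D.pairing ν) = 𝒢.id₁ (D.sharp G) := by
  have h := D.star₂_T_isInvertible (D.sharp (𝒢.tgt ν))
  simp (maxDischargeDepth := 9) [pairing, dom_sharpComp_star, cod_sharpComp_star, dom_inv h,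
    cod_inv h, sharp₁_id₁]
  rw [ht]

@[simp] theorem dom_copairing (ht : 𝒢.tgt ν = G) :
    𝒢.dom (D.copairing ν) = 𝒢.id₁ (D.sharp G) := by
  have h := D.sharpComp_star_isInvertible ν
  simp (maxDischargeDepth := 9) [copairing, dom_sharpComp_star, cod_sharpComp_star, dom_inv h,
    cod_inv h, sharp₁_id₁]
  rw [ht]

@[simp] theorem cod_copairing :
    𝒢.cod (D.copairing ν) = D.sharp₁ (D.star₁ ν) ∘₁ D.sharp₁ ν := by
  have h := D.sharpComp_star_isInvertible ν
  simp (maxDischargeDepth := 9) [copairing, dom_sharpComp_star, cod_sharpComp_star, dom_inv h,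
    cod_inv h, sharp₁_id₁]

/-- This is the swallowtail identity, since unsharping 1_G means untransposing η_G^*. -/
theorem unsharp_id₁_vcomp_cap (G : 𝒢.Hom₁) :
    D.unsharp (𝒢.id₁ G) ⊙ D.cap G (D.star₂ (D.T (D.sharp G))) = 𝒢.id₂ (D.star₁ (D.η G)) := by
  have h := D.untranspose_swallowtail G
  have e : D.unsharp (𝒢.id₁ G) = D.untranspose G (D.sharp G) (D.star₁ (D.η G)) := by
    simp (maxDischargeDepth := 9) [unsharp]
  rw [e, h]

/-- By the swallowtail, `unsharp` of 1_G is a left inverse of the capped 3-morphism, hence equal to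
its inverse. -/
theorem cap_inv_star₂_T (G : 𝒢.Hom₁) :
    D.cap G (𝒢.inv (D.star₂ (D.T (D.sharp G)))) = D.unsharp (𝒢.id₁ G) := by
  have h := D.star₂_T_isInvertible (D.sharp G)
  have e := congrArg (D.cap G) (vcomp_inv h)
  rw [D.cap_vcomp (by simp (maxDischargeDepth := 9) [dom_inv h]) (cod_inv h).symm] at e
  have e' := congrArg (fun x => x ⊙ D.cap G (𝒢.inv (D.star₂ (D.T (D.sharp G)))))
    (D.unsharp_id₁_vcomp_cap G)
  simp (maxDischargeDepth := 9) [e, cod_inv h, dom_inv h, sharp₁_id₁] at e'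
  simp (maxDischargeDepth := 9) [cap, sharp₁_id₁] at e'
  simpa only [cap] using e'.symm

/-- The capped inverse triangulator unsharps the identity. By naturality it passes #(ε_ν^*), leaving
ε_ν^* itself, and becomes `unsharp` of ν ∘ ν*, which `sharpComp` splits. -/
theorem cap_pairing (ht : 𝒢.tgt ν = G) :
    D.cap G (D.pairing ν) =
      (𝒢.id₂ (D.star₁ (D.η G)) ∘₂ (D.star₂ (D.ε ν) ▷₂ D.sharp G)) ⊙
        D.unsharpComp ν (D.star₁ ν) := by
  have h1 : 𝒢.source (𝒢.src ν) = 𝒢.source G := by rw [← ht, 𝒢.source_tgt]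
  have h2 : 𝒢.target (𝒢.src ν) = 𝒢.target G := by rw [← ht, 𝒢.target_tgt]
  have h := D.star₂_T_isInvertible (D.sharp G)
  have e1 := D.unsharp_natural (Φ := D.star₂ (D.ε ν)) (F := G) (G := G) rfl rfl (by simp [ht])
    (by simp [ht])
  have e2 := D.unsharp_vcomp_cap_sharpComp (E := G) (F := 𝒢.src ν) (ρ := D.star₁ ν) (by simp [ht]) (by simp) rfl ht
  simp [ht] at e1
  rw [pairing, ht, D.cap_vcomp, D.cap_vcomp, cap_inv_star₂_T, 𝒢.vcomp_eq_assoc e1, e2] <;>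
  simp (maxDischargeDepth := 9) [dom_sharpComp_star, cod_sharpComp_star, dom_inv h,
    cod_inv h, sharp₁_id₁, ht, h1, h2]

/-- `sharpComp` cancels against its inverse inside the copairing; naturality then extracts ε_ν, and
the swallowtail removes the triangulator. -/
theorem unsharpComp_vcomp_cap_copairing (ht : 𝒢.tgt ν = G) :
    D.unsharpComp ν (D.star₁ ν) ⊙ D.cap G (D.copairing ν) =
      𝒢.id₂ (D.star₁ (D.η G)) ∘₂ (D.ε ν ▷₂ D.sharp G) := by
  have h1 : 𝒢.source (𝒢.src ν) = 𝒢.source G := by rw [← ht, 𝒢.source_tgt]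
  have h2 : 𝒢.target (𝒢.src ν) = 𝒢.target G := by rw [← ht, 𝒢.target_tgt]
  have h := D.sharpComp_star_isInvertible ν
  have e1 := D.unsharp_natural (Φ := D.ε ν) (F := G) (G := G) rfl rfl (by simp [ht])
    (by simp [ht])
  have e2 := D.unsharp_vcomp_cap_sharpComp (E := G) (F := 𝒢.src ν) (ρ := D.star₁ ν) (by simp [ht]) (by simp) rfl ht
  have e3 : D.sharpComp ν (D.star₁ ν) ⊙ D.copairing ν =
      D.sharp₂ (D.ε ν) ⊙ D.star₂ (D.T (D.sharp G)) := by
    rw [copairing, ← 𝒢.vcomp_assoc, vcomp_inv h, ht] <;>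
    simp (maxDischargeDepth := 9) [dom_sharpComp_star, cod_sharpComp_star, dom_inv h,
      cod_inv h, sharp₁_id₁, ht, h1, h2]
  simp [ht] at e1
  rw [← e2, 𝒢.vcomp_assoc, ← D.cap_vcomp, e3, D.cap_vcomp, 𝒢.vcomp_eq_assoc e1,
    D.unsharp_id₁_vcomp_cap] <;>
  simp (maxDischargeDepth := 9) [dom_sharpComp_star, cod_sharpComp_star, dom_inv h,
    cod_inv h, sharp₁_id₁, ht, h1, h2]

/-- After capping and unsharping, the pairing resolves #μ ∘ #μ* ∘ #μ from one end and the copairing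
from the other. `unsharpComp_unsharpComp` reconciles the two, and the snake identity of μ remains.
-/
theorem pairing_copairing (hs : 𝒢.src μ = F) (ht : 𝒢.tgt μ = G) (hn : D.star₁ μ = n) :
    (D.pairing n ∘₂ 𝒢.id₂ (D.sharp₁ μ)) ⊙
      (𝒢.id₂ (D.sharp₁ μ) ∘₂ D.copairing μ) = 𝒢.id₂ (D.sharp₁ μ) := by
  have h1 : 𝒢.source F = 𝒢.source G := by rw [← ht, ← hs, 𝒢.source_tgt]
  have h2 : 𝒢.target F = 𝒢.target G := by rw [← ht, ← hs, 𝒢.target_tgt]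
  have hn' : D.star₁ n = μ := by rw [← hn, D.star₁_star₁]
  have hns : 𝒢.src n = G := by rw [← hn, D.src_star₁, ht]
  have hnt : 𝒢.tgt n = F := by rw [← hn, D.tgt_star₁, hs]
  have e1 := D.unsharpPast_natural (y := D.copairing μ) hs ht rfl rfl rfl
    (by simp (maxDischargeDepth := 9) [*])
  have e2 := D.unsharpUnder_natural (Φ := D.star₂ (D.ε n)) hs ht rfl rfl rfl
    (by simp (maxDischargeDepth := 9) [*])
  have e3 := D.unsharpComp_unsharpComp hs ht hns hnt
  have e4 := congrArg (fun x => x ∘₂ 𝒢.id₂ (F ◁₁ D.sharp₁ μ)) (D.cap_pairing hnt)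
  have e5 := congrArg (fun x => x ∘₂ 𝒢.id₂ (μ ▷₁ D.sharp G))
    (D.unsharpComp_vcomp_cap_copairing ht)
  have e6 := congrArg (fun x => 𝒢.id₂ (D.star₁ (D.η G)) ∘₂ (x ▷₂ D.sharp G)) (D.ε_snake μ)
  simp (maxDischargeDepth := 9) [h1, h2, hn, hn', hns, hnt, hs, ht, D.unsharpPast_id₁ ht] at e1
  simp (maxDischargeDepth := 9) [h1, h2, hn, hn', hns, hnt, hs, ht, D.unsharpUnder_id₁ hs] at e2
  simp (maxDischargeDepth := 9) [h1, h2, hn, hn', hns, hnt, hs, ht, cap] at e4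
  simp (maxDischargeDepth := 9) [h1, h2, hn, hn', hns, hnt, hs, ht, cap] at e5
  simp (maxDischargeDepth := 9) [h1, h2, hn, hn', hns, hnt, hs, ht] at e6
  -- It suffices to compare both sides after capping and composing with the invertible `unsharp μ`.
  refine D.cap_injective (F := F) ?_ ?_ ?_ ((D.unsharp_isInvertible μ).cancel_left ?_ ?_ ?_)
  · simp (maxDischargeDepth := 9) [h1, h2, hn, hn', hns, hnt, hs, ht]
  · simp (maxDischargeDepth := 9) [h1, h2, hn, hn', hns, hnt, hs, ht]
  · simp (maxDischargeDepth := 9) [h1, h2, hn, hn', hns, hnt, hs, ht]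
  · simp (maxDischargeDepth := 9) [h1, h2, hn, hn', hns, hnt, hs, ht]
  · simp (maxDischargeDepth := 9) [h1, h2, hn, hn', hns, hnt, hs, ht]
  · simp (maxDischargeDepth := 9) [h1, h2, hn, hn', hns, hnt, hs, ht, cap]
    rw [e4, 𝒢.vcomp_assoc, 𝒢.vcomp_eq_assoc e2, ← 𝒢.vcomp_eq_assoc e3, e1,
      𝒢.vcomp_eq_assoc' e5, 𝒢.vcomp_eq_assoc' e6, 𝒢.id_vcomp_of_eq] <;>
    simp (maxDischargeDepth := 9) [h1, h2, hn, hn', hns, hnt, hs, ht]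

/-- The same reduction with the two ends exchanged; it ends in the derived snake identity `ε_snake'`
of μ. -/
theorem copairing_pairing (hs : 𝒢.src μ = F) (ht : 𝒢.tgt μ = G) (hn : D.star₁ μ = n) :
    (𝒢.id₂ (D.sharp₁ μ) ∘₂ D.pairing μ) ⊙
      (D.copairing n ∘₂ 𝒢.id₂ (D.sharp₁ μ)) = 𝒢.id₂ (D.sharp₁ μ) := by
  have h1 : 𝒢.source F = 𝒢.source G := by rw [← ht, ← hs, 𝒢.source_tgt]
  have h2 : 𝒢.target F = 𝒢.target G := by rw [← ht, ← hs, 𝒢.target_tgt]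
  have hn' : D.star₁ n = μ := by rw [← hn, D.star₁_star₁]
  have hns : 𝒢.src n = G := by rw [← hn, D.src_star₁, ht]
  have hnt : 𝒢.tgt n = F := by rw [← hn, D.tgt_star₁, hs]
  have e1 := D.unsharpPast_natural (y := D.pairing μ) hs ht rfl rfl rfl
    (by simp (maxDischargeDepth := 9) [*])
  have e2 := D.unsharpUnder_natural (Φ := D.ε n) hs ht rfl rfl rfl
    (by simp (maxDischargeDepth := 9) [*])
  have e3 := D.unsharpComp_unsharpComp hs ht hns hnt
  have e4 := congrArg (fun x => x ∘₂ 𝒢.id₂ (μ ▷₁ D.sharp G)) (D.cap_pairing ht)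
  have e5 := congrArg (fun x => x ∘₂ 𝒢.id₂ (F ◁₁ D.sharp₁ μ))
    (D.unsharpComp_vcomp_cap_copairing hnt)
  have e6 := congrArg (fun x => 𝒢.id₂ (D.star₁ (D.η G)) ∘₂ (x ▷₂ D.sharp G)) (D.ε_snake' μ)
  simp (maxDischargeDepth := 9) [h1, h2, hn, hn', hns, hnt, hs, ht, D.unsharpPast_id₁ ht] at e1
  simp (maxDischargeDepth := 9) [h1, h2, hn, hn', hns, hnt, hs, ht, D.unsharpUnder_id₁ hs] at e2
  simp (maxDischargeDepth := 9) [h1, h2, hn, hn', hns, hnt, hs, ht, cap] at e4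
  simp (maxDischargeDepth := 9) [h1, h2, hn, hn', hns, hnt, hs, ht, cap] at e5
  simp (maxDischargeDepth := 9) [h1, h2, hn, hn', hns, hnt, hs, ht] at e6
  refine D.cap_injective (F := F) ?_ ?_ ?_ ((D.unsharp_isInvertible μ).cancel_left ?_ ?_ ?_)
  · simp (maxDischargeDepth := 9) [h1, h2, hn, hn', hns, hnt, hs, ht]
  · simp (maxDischargeDepth := 9) [h1, h2, hn, hn', hns, hnt, hs, ht]
  · simp (maxDischargeDepth := 9) [h1, h2, hn, hn', hns, hnt, hs, ht]
  · simp (maxDischargeDepth := 9) [h1, h2, hn, hn', hns, hnt, hs, ht]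
  · simp (maxDischargeDepth := 9) [h1, h2, hn, hn', hns, hnt, hs, ht]
  · simp (maxDischargeDepth := 9) [h1, h2, hn, hn', hns, hnt, hs, ht, cap]
    rw [𝒢.vcomp_eq_assoc e1, e4, 𝒢.vcomp_assoc, 𝒢.vcomp_eq_assoc e3, e5, e2,
      𝒢.vcomp_eq_assoc' e6, 𝒢.id_vcomp_of_eq] <;>
    simp (maxDischargeDepth := 9) [h1, h2, hn, hn', hns, hnt, hs, ht]

end Duals

end GrayCategory

/-! ### Δ as the mate of the pairing. -/

namespace GrayCategory

open TwoCategory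

namespace Duals

variable {𝒢 : GrayCategory.{u₀, u₁, u₂, u₃}} (D : 𝒢.Duals)
variable {E F G P : 𝒢.Hom₁} {μ ν n ρ : 𝒢.Hom₂} {Φ : 𝒢.Hom₃}

/-- A hexagon identity merges the tensorators of η_{E^#} and of ρ with #ν, and unfolding `unsharp ν`
gives the other two factors. For ρ = ν* these are the three middle factors of Δ_ν. -/
theorem sharpComp_eq (hρs : 𝒢.src ρ = E) (hρt : 𝒢.tgt ρ = F) (hνs : 𝒢.src ν = F)
    (hνt : 𝒢.tgt ν = G) :
    D.sharpComp ν ρ =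
      (𝒢.id₂ ((D.sharp E ◁₁ D.star₁ (D.η G)) ∘₁ (D.sharp E ◁₁ (ν ▷₁ D.sharp G))) ∘₂
        (D.sharp E ◁₂ (D.T F ▷₂ D.sharp G)) ∘₂
        𝒢.id₂ ((D.sharp E ◁₁ (ρ ▷₁ D.sharp G)) ∘₁ (D.η (D.sharp E) ▷₁ D.sharp G))) ⊙
      (𝒢.σ (D.sharp E ◁₁ D.star₁ (D.η F)) (D.star₁ (D.η G) ∘₁ (ν ▷₁ D.sharp G)) ∘₂
        𝒢.id₂ ((D.sharp E ◁₁ (F ◁₁ (D.η (D.sharp F) ▷₁ D.sharp G))) ∘₁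
          (D.sharp E ◁₁ (ρ ▷₁ D.sharp G)) ∘₁ (D.η (D.sharp E) ▷₁ D.sharp G))) ⊙
      (𝒢.id₂ (D.sharp E ◁₁ D.star₁ (D.η F)) ∘₂
        𝒢.σ ((D.sharp E ◁₁ ρ) ∘₁ D.η (D.sharp E)) (D.sharp₁ ν)) := by
  have h1 : 𝒢.source E = 𝒢.source G := by rw [← hνt, ← hρs, 𝒢.source_tgt, hνs, ← hρt, 𝒢.source_tgt]
  have h2 : 𝒢.target E = 𝒢.target G := by rw [← hνt, ← hρs, 𝒢.target_tgt, hνs, ← hρt, 𝒢.target_tgt]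
  have h3 : 𝒢.source F = 𝒢.source G := by rw [← hνt, ← hνs, 𝒢.source_tgt]
  have h4 : 𝒢.target F = 𝒢.target G := by rw [← hνt, ← hνs, 𝒢.target_tgt]
  have e := 𝒢.σ_hcomp_left (D.sharp E ◁₁ ρ) (D.η (D.sharp E)) (D.sharp₁ ν)
    (by simp (maxDischargeDepth := 9) [*]) (by simp (maxDischargeDepth := 9) [*])
  simp (maxDischargeDepth := 9) [hρs, hρt, hνs, hνt, h1, h2, h3, h4] at e
  obtain ⟨R, hR⟩ : ∃ R, R = (D.sharp E ◁₁ (ρ ▷₁ D.sharp G)) ∘₁ (D.η (D.sharp E) ▷₁ D.sharp G) :=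
    ⟨_, rfl⟩
  have hRt : 𝒢.tgt R = D.sharp E □₀ (F □₀ D.sharp G) := by
    rw [hR]; simp (maxDischargeDepth := 9) [hρs, hρt, h1, h2, h3, h4]
  have hc : (D.sharp E ◁₂ D.unsharp ν) ∘₂ 𝒢.id₂ R =
      (𝒢.id₂ ((D.sharp E ◁₁ D.star₁ (D.η G)) ∘₁ (D.sharp E ◁₁ (ν ▷₁ D.sharp G))) ∘₂
        (D.sharp E ◁₂ (D.T F ▷₂ D.sharp G)) ∘₂ 𝒢.id₂ R) ⊙
      (𝒢.σ (D.sharp E ◁₁ D.star₁ (D.η F)) (D.star₁ (D.η G) ∘₁ (ν ▷₁ D.sharp G)) ∘₂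
        𝒢.id₂ ((D.sharp E ◁₁ (F ◁₁ (D.η (D.sharp F) ▷₁ D.sharp G))) ∘₁ R)) := by
    simp (maxDischargeDepth := 9) [hνs, hνt, h1, h2, h3, h4, hRt, unsharp, untranspose]
  rw [← 𝒢.vcomp_assoc, ← hR, ← hc, e, hR]
  · simp (maxDischargeDepth := 9) [hρs, hρt, hνs, hνt, h1, h2, h3, h4, sharpComp, transpose₂,
      slide]
  · rw [← hR]
    simp (maxDischargeDepth := 9) [hνs, hνt, h1, h2, h3, h4, hRt]
  · have hB := D.sharp₁_eq hνs hνt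
    simp (maxDischargeDepth := 9) [hνs, hνt, h1, h2, h3, h4, transpose₁] at hB
    simp (maxDischargeDepth := 12) [hνs, hνt, hρs, hρt, h1, h2, h3, h4, hB]

/-- Apart from the initial ε, every factor of Δ_ν is whiskered with *#*ν = (#ν*)^*; the whiskered
factors compose to the pairing. -/
theorem Delta_eq_mate (ν : 𝒢.Hom₂) :
    D.Delta ν = D.mate (D.sharp₁ (D.star₁ ν)) (D.sharp₁ ν) (D.pairing ν) := by
  obtain ⟨F, hs⟩ : ∃ F, 𝒢.src ν = F := ⟨_, rfl⟩
  obtain ⟨G, ht⟩ : ∃ G, 𝒢.tgt ν = G := ⟨_, rfl⟩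
  have h1 : 𝒢.source F = 𝒢.source G := by rw [← ht, ← hs, 𝒢.source_tgt]
  have h2 : 𝒢.target F = 𝒢.target G := by rw [← ht, ← hs, 𝒢.target_tgt]
  have hi := D.star₂_T_isInvertible (D.sharp G)
  have hw := D.sharpComp_eq (ρ := D.star₁ ν) (E := G) (F := F) (G := G)
    (by simp [*]) (by simp [*]) hs ht
  have hB := D.sharp₁_eq hs ht
  have hA := D.sharp₁_eq (ν := D.star₁ ν) (F := G) (G := F) (by simp [*]) (by simp [*])
  have hC := D.sharp₁_eq (ν := ν ∘₁ D.star₁ ν) (F := G) (G := G) (by simp [*]) (by simp [*])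
  simp (maxDischargeDepth := 9) [hs, ht, h1, h2, transpose₁] at hB hA hC
  rw [PlanarStructure.mate, pairing, hw, Delta, starSharpStar₁, 𝒢.id₂_hcomp₂_vcomp_chain, sharp₂, hs, ht]
  · simp only [PlanarStructure.dom_star₂, PlanarStructure.cod_ε, PlanarStructure.star₁_star₁]
    simp (maxDischargeDepth := 9) only [D.star₁_hcomp₁, D.star₁_star₁, D.src_star₁, D.tgt_star₁,
      𝒢.src_hcomp₁, 𝒢.tgt_hcomp₁, ht]
  · simp (maxDischargeDepth := 9) [dom_inv hi, sharp₁_id₁, ht]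
  · simp (maxDischargeDepth := 12) [hs, ht, h1, h2, hC]
  · simp (maxDischargeDepth := 12) [hs, ht, h1, h2]
  · simp (maxDischargeDepth := 12) [hs, ht, h1, h2, hB]
  · simp (maxDischargeDepth := 12) [hs, ht, h1, h2]
  · simp (maxDischargeDepth := 12) [hs, ht, h1, h2, hA]

end Duals

end GrayCategory

/-! ### Spatial implies spherical. -/

open GrayCategory in
theorem lemma7p2 (𝒢 : GrayCategory.{u₀, u₁, u₂, u₃}) (D : 𝒢.Duals) (hD : D.IsSpatial) :
    D.IsSpherical := by
  intro F G μ Ψ hs ht hd hc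
  -- Writing n for μ* makes the situation symmetric: each of μ and n is the star of the other.
  obtain ⟨n, hn⟩ : ∃ n, D.star₁ μ = n := ⟨_, rfl⟩
  have h1 : 𝒢.source F = 𝒢.source G := by rw [← ht, ← hs, 𝒢.source_tgt]
  have h2 : 𝒢.target F = 𝒢.target G := by rw [← ht, ← hs, 𝒢.target_tgt]
  have hn' : D.star₁ n = μ := by rw [← hn, D.star₁_star₁]
  have hns : 𝒢.src n = G := by rw [← hn, D.src_star₁, ht]
  have hnt : 𝒢.tgt n = F := by rw [← hn, D.tgt_star₁, hs]
  -- The only use of spatiality.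
  have hm : D.mate (D.sharp₁ n) (D.sharp₁ μ) (D.pairing μ) =
      D.star₂ (D.mate (D.sharp₁ μ) (D.sharp₁ n) (D.pairing n)) := by
    have h := hD μ
    rw [Duals.starDeltaStar, D.Delta_eq_mate, D.Delta_eq_mate, hn, hn'] at h
    exact h
  have eR := PlanarStructure.traceR_eq (P := D.toPlanarStructure) (a := D.sharp₁ n)
    (b := D.sharp₁ μ) (p := D.pairing μ) (p' := D.pairing n) (g := D.copairing μ)
    (Φ := D.sharp₂ Ψ) (by simp [*]) (by simp [*]) (by simp [*]) (by simp [*]) (by simp [*])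
    (by simp [*]) (by simp [*]) (by simp [*]) (D.pairing_copairing hs ht hn) hm (by simp [*])
    (by simp [*])
  have eL := PlanarStructure.traceL_eq (P := D.toPlanarStructure) (a := D.sharp₁ n)
    (b := D.sharp₁ μ) (p := D.pairing μ) (p' := D.pairing n) (g := D.copairing n)
    (Φ := D.sharp₂ Ψ) (by simp [*]) (by simp [*]) (by simp [*]) (by simp [*]) (by simp [*])
    (by simp [*]) (by simp [*]) (by simp [*]) (D.copairing_pairing hs ht hn) hm (by simp [*])
    (by simp [*])
  constructor
  · have e1 := D.unsharpComp_natural_left hns hnt hs ht hd hc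
    have e2 := D.cap_pairing ht
    have e3 := D.unsharpComp_vcomp_cap_copairing ht
    change _ = D.cap G (D.traceR (D.sharp₂ Ψ))
    rw [hn] at e2 e3
    rw [← eR, D.cap_vcomp, D.cap_vcomp, e2, 𝒢.vcomp_assoc, 𝒢.vcomp_eq_assoc e1, e3]
    all_goals simp (maxDischargeDepth := 9) [hn, hn', hns, hnt, hs, ht, h1, h2, hd, hc,
      Duals.trL, Duals.trR]
  -- With the pairing and copairing of n = μ* instead, Ψ ends up on the right of μ*, which gives the
  -- right trace.
  · have e1 := D.unsharpComp_natural_right hs ht hns hnt hd hc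
    have e2 := D.cap_pairing hnt
    have e3 := D.unsharpComp_vcomp_cap_copairing hnt
    change _ = D.cap F (D.traceL (D.sharp₂ Ψ))
    rw [hn'] at e2 e3
    rw [← eL, D.cap_vcomp, D.cap_vcomp, e2, 𝒢.vcomp_assoc, 𝒢.vcomp_eq_assoc e1, e3]
    all_goals simp (maxDischargeDepth := 9) [hn, hn', hns, hnt, hs, ht, h1, h2, hd, hc,
      Duals.trL, Duals.trR]
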